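/- **Notation.** A compatible couple $\bar A=(A_0,A_1)$ consists of two complex Banach spaces continuously embedded in a common Hausdorff topological vector space; $A_0\cap A_1$ carries the norm $\max(\|a\|_{A_0},\|a\|_{A_1})$ and $A_0+A_1$ the norm $\inf\{\|a_0\|_{A_0}+\|a_1\|_{A_1}: a=a_0+a_1\}$. Let $\mathbb S=\{0<\operatorname{Re}z<1\}$ and let $\mathcal F(\bar A)$ be the space of all $f:\overline{\mathbb S}\to A_0+A_1$ such that $l\circ f$ is bounded and continuous on $\overline{\mathbb S}$ and holomorphic in $\mathbb S$ for every $l\in(A_0+A_1)^*$, and such that, for $j=0,1$, $t\mapsto f(j+it)$ is a bounded continuous function into $A_j$; put $\|f\|_{\mathcal F}=\max_{j}\sup_t\|f(j+it)\|_{A_j}$. For $0<\theta<1$ and $a\in A_0+A_1$ let $$\|a\|_\theta=\inf\{\|f\|_{\mathcal F}: f(\theta)=a\},\quad \|a\|_{\delta'(\theta)}=\inf\{\|f\|_{\mathcal F}: f'(\theta)=a\},\quad \|a\|^{\delta'(\theta)}=\inf\{\|f\|_{\mathcal F}: f(\theta)=a,\ f'(\theta)=0\}$$ (infima over $f\in\mathcal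 F(\bar A)$, with $\inf\emptyset=\infty$) and $$\|a\|_{\delta(0)}=\limsup_{\theta\to0^+}\|a\|_\theta,\quad \|a\|_{\delta'(0)}=\limsup_{\theta\to0^+}\frac{\|a\|_{\delta'(\theta)}}{\theta},\quad \|a\|^{\delta'(0)}=\limsup_{\theta\to0^+}\|a\|^{\delta'(\theta)}.$$ Let $\bar A_{\delta(0)}$, $\bar A_{\delta'(0)}$ be the subspaces of $A_0+A_1$ on which $\|\cdot\|_{\delta(0)}$, respectively $\|\cdot\|_{\delta'(0)}$, is finite, with these norms (they need not be complete). For a dense linear subspace $D$ of $A_0\cap A_1$ let $D_{\delta(0)}$ and $D^{\delta'(0)}$ be the completions of $D$ for $\|\cdot\|_{\delta(0)}$ and $\|\cdot\|^{\delta'(0)}$. We say that a linear map $L$ on $D$ is bounded with constant $K$ from $D_{\delta(0)}$ to $\bar B_{\delta(0)}$ if $L$ maps $D$ into $\bar B_{\delta(0)}$ and $\|Ld\|_{\delta(0)}\le K\|d\|_{\delta(0)}$ for $d\in D$, so that $L$ extends to a bounded operator of norm at most $K$ from $D_{\delta(0)}$ to the completion of $\bar B_{\delta(0)}$; similarly from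 $D^{\delta'(0)}$ to $\bar B_{\delta'(0)}$. Let $\Omega=\{\operatorname{Re}\xi>0\}$. A family of linear operators $T_\xi:D\to B_0+B_1$, $\xi\in\overline\Omega$, is called analytic if for every $d\in D$: $\xi\mapsto l(T_\xi d)$ is continuous on $\overline\Omega$ and holomorphic in $\Omega$ for every $l\in(B_0+B_1)^*$; $t\mapsto T_{it}d$ is a continuous function into $B_0$; and for every $\alpha>0$, $t\mapsto T_{\alpha+it}d$ is a continuous function into $B_1$. **Theorem.** Let $M_0,M,C>0$ and $s\in(0,1)$. There are constants $K,K'$, depending only on $M_0,M,C,s$, such that the following holds for all compatible couples $\bar A,\bar B$ of Banach spaces, every dense linear subspace $D$ of $A_0\cap A_1$, every analytic family $(T_\xi)_{\xi\in\overline\Omega}$ of linear operators $T_\xi:D\to B_0+B_1$, and every constant $M_1$. Suppose that for all $t\in\mathbb R$, $\alpha>0$ and $d\in D$ $$\|T_{it}d\|_{B_0}\le M_0e^{C|t|^s}\|d\|_{A_0},\qquad \|T_{\alpha+it}d\|_{B_1}\le M_1M^\alpha e^{C|t|^s}\|d\|_{A_1}.$$ Then $T_1$ is bounded from $D_{\delta(0)}$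 to $\bar B_{\delta(0)}$ with constant $K$; moreover, for every $d\in D$ the function $\xi\mapsto T_\xi d$ is differentiable at $\xi=1$ in $B_0+B_1$, and the derivative operator $T_1'd=\frac{d}{d\xi}T_\xi d\big|_{\xi=1}$ is bounded from $D^{\delta'(0)}$ to $\bar B_{\delta'(0)}$ with constant $K'$. In particular the bounds do not depend on $M_1$. The exponent $s=1$ is not allowed: there are compatible couples $\bar A,\bar B$, a dense subspace $D$ of $A_0\cap A_1$, an analytic family $(T_\xi)$ and constants $M_0,M,C>0$ and $M_1$ for which the two displayed estimates hold with $s=1$, but $T_1$ is not bounded from $D_{\delta(0)}$ to $\bar B_{\delta(0)}$ with any constant. -/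

import Mathlib

open Filter Topology Set
open scoped ENNReal BoundedContinuousFunction

noncomputable section

/-! ### Extended seminorms, the spaces on which they are finite, and their completions -/

/-- A seminorm on a complex vector space that may take the value `∞`. -/
structure ExtSeminorm (E : Type*) [AddCommGroup E] [Module ℂ E] where
  toFun : E → ℝ≥0∞
  map_zero' : toFun 0 = 0
  add_le' : ∀ x y, toFun (x + y) ≤ toFun x + toFun y
  smul_le' : ∀ (c : ℂ) (x : E), toFun (c • x) ≤ ‖c‖ₑ * toFun x

namespace ExtSeminorm

theorem limsup_add_le_add {ι : Type*} (l : Filter ι) (u v : ι → ℝ≥0∞) :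
    limsup (fun i => u i + v i) l ≤ limsup u l + limsup v l := by
  refine ENNReal.le_of_forall_pos_le_add fun ε hε htop => ?_
  obtain ⟨hu, hv⟩ := ENNReal.add_lt_top.1 htop
  have hε2 : ((ε : ℝ≥0∞) / 2) ≠ 0 := by simp [hε.ne']
  have h1 := eventually_lt_of_limsup_lt (ENNReal.lt_add_right hu.ne hε2)
  have h2 := eventually_lt_of_limsup_lt (ENNReal.lt_add_right hv.ne hε2)
  refine limsup_le_of_le (by isBoundedDefault) ?_
  filter_upwards [h1, h2] with i h h'
  refine (add_le_add h.le h'.le).trans (le_of_eq ?_)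
  rw [add_add_add_comm, ENNReal.add_halves]

variable {E F : Type*} [AddCommGroup E] [Module ℂ E] [AddCommGroup F] [Module ℂ F]

instance : CoeFun (ExtSeminorm E) (fun _ => E → ℝ≥0∞) := ⟨ExtSeminorm.toFun⟩

/-- The subspace of the vectors of finite seminorm. -/
def finite (p : ExtSeminorm E) : Submodule ℂ E where
  carrier := {x | p x < ∞}
  zero_mem' := by simp [p.map_zero']
  add_mem' := fun {x y} hx hy =>
    lt_of_le_of_lt (p.add_le' x y) (ENNReal.add_lt_top.2 ⟨hx, hy⟩)
  smul_mem' := fun c x hx =>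
    lt_of_le_of_lt (p.smul_le' c x) (ENNReal.mul_lt_top enorm_lt_top hx)

/-- The vectors of finite seminorm, as a seminormed space under `p` (and not under a norm that
`E` may carry). -/
def Space (p : ExtSeminorm E) : Type _ := p.finite

instance (p : ExtSeminorm E) : AddCommGroup p.Space := inferInstanceAs (AddCommGroup p.finite)

instance (p : ExtSeminorm E) : Module ℂ p.Space := inferInstanceAs (Module ℂ p.finite)

/-- A vector of finite seminorm, as a point of the seminormed space. -/
def point (p : ExtSeminorm E) (x : E) (hx : p x < ∞) : p.Space := ⟨x, hx⟩

/-- `p` as a real valued seminorm on the vectors where it is finite. -/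
def toSeminorm (p : ExtSeminorm E) : Seminorm ℂ p.Space :=
  Seminorm.ofSMulLE (fun x : p.Space => (p (Subtype.val x)).toReal)
    (by
      have h : p (0 : E) = 0 := p.map_zero'
      change (p (0 : E)).toReal = 0
      simp [h])
    (fun x y => by
      rw [← ENNReal.toReal_add (ne_of_lt x.2) (ne_of_lt y.2)]
      exact ENNReal.toReal_mono (ENNReal.add_lt_top.2 ⟨x.2, y.2⟩).ne (p.add_le' x.1 y.1))
    (fun c x => by
      have h := ENNReal.toReal_mono (ENNReal.mul_lt_top enorm_lt_top x.2).ne (p.smul_le' c x.1)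
      rw [ENNReal.toReal_mul, toReal_enorm] at h
      exact h)

instance (p : ExtSeminorm E) : SeminormedAddCommGroup p.Space :=
  p.toSeminorm.toAddGroupSeminorm.toSeminormedAddCommGroup

instance (p : ExtSeminorm E) : NormedSpace ℂ p.Space where
  norm_smul_le c x := (map_smul_eq_mul p.toSeminorm c x).le

theorem norm_point (p : ExtSeminorm E) (x : E) (hx : p x < ∞) : ‖p.point x hx‖ = (p x).toReal := rfl

/-- The completion of the space of vectors of finite seminorm. -/
abbrev Compl (p : ExtSeminorm E) : Type _ := UniformSpace.Completion p.Space

/-- The pullback of an extended seminorm under a linear map. -/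
def comap (p : ExtSeminorm F) (f : E →ₗ[ℂ] F) : ExtSeminorm E where
  toFun x := p (f x)
  map_zero' := by simp [p.map_zero']
  add_le' x y := by simpa using p.add_le' (f x) (f y)
  smul_le' c x := by simpa using p.smul_le' c (f x)

/-- The infimum over a linear relation: for a normed space `G` and a subspace `R` of `G × E`,
the extended seminorm `x ↦ inf {‖g‖ : (g, x) ∈ R}` (which is `∞` if there is no such `g`). -/
def ofRel {G : Type*} [NormedAddCommGroup G] [NormedSpace ℂ G] (R : Submodule ℂ (G × E)) :
    ExtSeminorm E where
  toFun x := ⨅ (g : G) (_ : (g, x) ∈ R), ‖g‖ₑ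
  map_zero' := by
    refine le_antisymm ?_ bot_le
    refine (iInf₂_le (0 : G) R.zero_mem).trans ?_
    simp
  add_le' x y := by
    refine ENNReal.le_of_forall_pos_le_add fun ε hε _ => ?_
    by_cases hx : (⨅ (g : G) (_ : (g, x) ∈ R), ‖g‖ₑ) = ∞
    · simp [hx]
    by_cases hy : (⨅ (g : G) (_ : (g, y) ∈ R), ‖g‖ₑ) = ∞
    · simp [hy]
    have hε2 : ((ε : ℝ≥0∞) / 2) ≠ 0 := by simp [hε.ne']
    have h1 := ENNReal.lt_add_right hx hε2
    have h2 := ENNReal.lt_add_right hy hε2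
    simp only [iInf_lt_iff] at h1 h2
    obtain ⟨g, hg, hg'⟩ := h1
    obtain ⟨h, hh, hh'⟩ := h2
    have hgh : (g + h, x + y) ∈ R := R.add_mem hg hh
    refine (iInf₂_le (g + h) hgh).trans ((enorm_add_le g h).trans ?_)
    refine (add_le_add hg'.le hh'.le).trans (le_of_eq ?_)
    rw [add_add_add_comm, ENNReal.add_halves]
  smul_le' c x := by
    rcases eq_or_ne c 0 with rfl | hc
    · refine (iInf₂_le (0 : G) (by rw [zero_smul]; exact R.zero_mem)).trans ?_
      simp
    rw [ENNReal.mul_iInf_of_ne (by simpa using hc) enorm_ne_top]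
    refine le_iInf fun g => ?_
    rw [ENNReal.mul_iInf_of_ne (by simpa using hc) enorm_ne_top]
    refine le_iInf fun hg => ?_
    have hgc : (c • g, c • x) ∈ R := R.smul_mem c hg
    exact (iInf₂_le (c • g) hgc).trans (enorm_smul_le)

/-- The upper limit as `θ → 0⁺` of the extended seminorms `w θ * p θ` with weights `w θ`. -/
def limsupZero (w : ℝ → ℝ≥0∞) (p : ℝ → ExtSeminorm E) : ExtSeminorm E where
  toFun x := limsup (fun θ => w θ * p θ x) (𝓝[>] (0 : ℝ))
  map_zero' := by
    have : ∀ θ, p θ 0 = 0 := fun θ => (p θ).map_zero'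
    simp [this]
  add_le' x y := by
    refine le_trans (limsup_le_limsup (Eventually.of_forall fun θ => ?_)) (limsup_add_le_add _ _ _)
    change w θ * p θ (x + y) ≤ w θ * p θ x + w θ * p θ y
    rw [← mul_add]
    exact mul_le_mul_right ((p θ).add_le' x y) _
  smul_le' c x := by
    rw [← ENNReal.limsup_const_mul_of_ne_top enorm_ne_top]
    refine limsup_le_limsup (Eventually.of_forall fun θ => ?_)
    change w θ * p θ (c • x) ≤ ‖c‖ₑ * (w θ * p θ x)
    rw [mul_left_comm]
    exact mul_le_mul_right ((p θ).smul_le' c x) _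

end ExtSeminorm

/-- `L` is defined on a vector space `E` on which `p` is finite, takes its values in the space where
`q` is finite, is bounded from `(E, p)` to that space with constant `K`, and hence has a bounded
linear extension to the completions. -/
def IsBoundedExt {E F : Type*} [AddCommGroup E] [Module ℂ E] [AddCommGroup F] [Module ℂ F]
    (p : ExtSeminorm E) (q : ExtSeminorm F) (L : E → F) (K : ℝ) : Prop :=
  ∃ S : p.Compl →L[ℂ] q.Compl, ‖S‖ ≤ K ∧
    ∀ x : E, ∃ (hx : p x < ∞) (hLx : q (L x) < ∞),
      S (p.point x hx : p.Compl) = (q.point (L x) hLx : q.Compl)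

/-! ### Compatible couples of Banach spaces -/

/-- Two complex Banach spaces that are continuously embedded in one Hausdorff topological
vector space. -/
structure CompatibleCouple where
  X₀ : Type*
  X₁ : Type*
  V : Type*
  [normed₀ : NormedAddCommGroup X₀]
  [space₀ : NormedSpace ℂ X₀]
  [complete₀ : CompleteSpace X₀]
  [normed₁ : NormedAddCommGroup X₁]
  [space₁ : NormedSpace ℂ X₁]
  [complete₁ : CompleteSpace X₁]
  [group : AddCommGroup V]
  [module : Module ℂ V]
  [top : TopologicalSpace V]
  [topGroup : IsTopologicalAddGroup V]
  [contSMul : ContinuousSMul ℂ V]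
  [t2 : T2Space V]
  ι₀ : X₀ →L[ℂ] V
  ι₁ : X₁ →L[ℂ] V
  inj₀ : Function.Injective ι₀
  inj₁ : Function.Injective ι₁

namespace CompatibleCouple

attribute [instance] normed₀ space₀ complete₀ normed₁ space₁ complete₁ group module top topGroup
  contSMul t2

variable (A : CompatibleCouple)

/-- The intersection `A₀ ∩ A₁` as the space of the pairs `(a₀, a₁)` with the same image in the
ambient space. Its norm, inherited from the product, is `max ‖a₀‖ ‖a₁‖`. -/
def Inter : Submodule ℂ (A.X₀ × A.X₁) where
  carrier := {x | A.ι₀ x.1 = A.ι₁ x.2}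
  zero_mem' := by simp
  add_mem' := fun {x y} hx hy => by
    simp only [mem_ofPred_eq, Prod.fst_add, Prod.snd_add, map_add] at *
    rw [hx, hy]
  smul_mem' := fun c x hx => by
    simp only [mem_ofPred_eq, Prod.smul_fst, Prod.smul_snd, map_smul] at *
    rw [hx]

/-- The pairs `(a₀, a₁)` with `a₀ + a₁ = 0` in the ambient space. -/
def nullPairs : Submodule ℂ (WithLp 1 (A.X₀ × A.X₁)) where
  carrier := {x | A.ι₀ x.fst + A.ι₁ x.snd = 0}
  zero_mem' := by simp
  add_mem' := fun {x y} hx hy => by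
    simp only [mem_ofPred_eq, WithLp.add_fst, WithLp.add_snd, map_add] at *
    rw [add_add_add_comm, hx, hy, add_zero]
  smul_mem' := fun c x hx => by
    simp only [mem_ofPred_eq, WithLp.smul_fst, WithLp.smul_snd, map_smul] at *
    rw [← smul_add, hx, smul_zero]

instance isClosed_nullPairs : IsClosed (A.nullPairs : Set (WithLp 1 (A.X₀ × A.X₁))) := by
  have h : Continuous fun x : WithLp 1 (A.X₀ × A.X₁) => A.ι₀ x.fst + A.ι₁ x.snd := by fun_prop
  exact isClosed_singleton.preimage h

/-- The sum `A₀ + A₁`: the pairs `(a₀, a₁)` up to equality of `a₀ + a₁` in the ambient space. Its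
norm is the quotient norm `inf {‖a₀‖ + ‖a₁‖ : a = a₀ + a₁}`. -/
abbrev Sum : Type _ := WithLp 1 (A.X₀ × A.X₁) ⧸ A.nullPairs

/-- The inclusion of `A₀` into `A₀ + A₁`. -/
def incl₀ : A.X₀ →ₗ[ℂ] A.Sum :=
  A.nullPairs.mkQ ∘ₗ (WithLp.linearEquiv 1 ℂ (A.X₀ × A.X₁)).symm.toLinearMap ∘ₗ
    LinearMap.inl ℂ A.X₀ A.X₁

/-- The inclusion of `A₁` into `A₀ + A₁`. -/
def incl₁ : A.X₁ →ₗ[ℂ] A.Sum :=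
  A.nullPairs.mkQ ∘ₗ (WithLp.linearEquiv 1 ℂ (A.X₀ × A.X₁)).symm.toLinearMap ∘ₗ
    LinearMap.inr ℂ A.X₀ A.X₁

/-- The inclusion of `A₀ ∩ A₁` into `A₀ + A₁`. -/
def inclInter : A.Inter →ₗ[ℂ] A.Sum := A.incl₀ ∘ₗ LinearMap.fst ℂ A.X₀ A.X₁ ∘ₗ A.Inter.subtype

/-! ### The Calderón space of analytic functions on the strip -/

/-- The algebra of the strip: `g` is bounded and continuous on `0 ≤ Re z ≤ 1` and holomorphic
in `0 < Re z < 1`. -/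
def _root_.MemStripAlgebra (g : ℂ → ℂ) : Prop :=
  ContinuousOn g {z | 0 ≤ z.re ∧ z.re ≤ 1} ∧ DifferentiableOn ℂ g {z | 0 < z.re ∧ z.re < 1} ∧
    ∃ R : ℝ, ∀ z : ℂ, 0 ≤ z.re → z.re ≤ 1 → ‖g z‖ ≤ R

/-- The space `𝓕(A₀, A₁)`: functions `f` on the closed strip with values in `A₀ + A₁` such that
`l ∘ f` is in the algebra of the strip for every bounded functional `l`, together with their boundary
functions `t ↦ f (j + i t)`, which are bounded and continuous into `A_j`. The boundary functions
are determined by `f`; the values of `f` off the closed strip play no role. -/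
def calderon : Submodule ℂ ((ℂ → A.Sum) × (ℝ →ᵇ A.X₀) × (ℝ →ᵇ A.X₁)) where
  carrier := {x | (∀ l : StrongDual ℂ A.Sum, MemStripAlgebra fun z => l (x.1 z)) ∧
    (∀ t : ℝ, x.1 (t * Complex.I) = A.incl₀ (x.2.1 t)) ∧
    (∀ t : ℝ, x.1 (1 + t * Complex.I) = A.incl₁ (x.2.2 t))}
  zero_mem' := by
    refine ⟨fun l => ⟨?_, ?_, 0, ?_⟩, ?_, ?_⟩ <;> simp [continuousOn_const]
  add_mem' := by
    rintro x y ⟨hx, hx0, hx1⟩ ⟨hy, hy0, hy1⟩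
    refine ⟨fun l => ?_, fun t => ?_, fun t => ?_⟩
    · obtain ⟨hc, hd, R, hR⟩ := hx l
      obtain ⟨hc', hd', R', hR'⟩ := hy l
      simp only [Prod.fst_add, Pi.add_apply, map_add]
      exact ⟨hc.add hc', hd.add hd', R + R', fun z h0 h1 =>
        (norm_add_le _ _).trans (add_le_add (hR z h0 h1) (hR' z h0 h1))⟩
    · simp [hx0, hy0]
    · simp [hx1, hy1]
  smul_mem' := by
    rintro c x ⟨hx, hx0, hx1⟩
    refine ⟨fun l => ?_, fun t => ?_, fun t => ?_⟩
    · obtain ⟨hc, hd, R, hR⟩ := hx l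
      simp only [Prod.smul_fst, Pi.smul_apply, map_smul]
      exact ⟨hc.const_smul c, hd.const_smul c, ‖c‖ * R, fun z h0 h1 => by
        rw [norm_smul]; exact mul_le_mul_of_nonneg_left (hR z h0 h1) (norm_nonneg c)⟩
    · simp [hx0]
    · simp [hx1]

/-- For a linear condition `P f a` on `f ∈ 𝓕(A₀, A₁)` and `a ∈ A₀ + A₁`, the relation between the
boundary functions of `f` and `a`. The norm of `𝓕(A₀, A₁)` is the product norm
`max_j sup_t ‖f (j + i t)‖_{A_j}` of the boundary functions. -/
def boundaryRel (P : Submodule ℂ ((ℂ → A.Sum) × A.Sum)) :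
    Submodule ℂ (((ℝ →ᵇ A.X₀) × (ℝ →ᵇ A.X₁)) × A.Sum) where
  carrier := {x | ∃ f : ℂ → A.Sum, (f, x.1) ∈ A.calderon ∧ (f, x.2) ∈ P}
  zero_mem' := ⟨0, A.calderon.zero_mem, P.zero_mem⟩
  add_mem' := by
    rintro x y ⟨f, hf, hf'⟩ ⟨g, hg, hg'⟩
    exact ⟨f + g, A.calderon.add_mem hf hg, P.add_mem hf' hg'⟩
  smul_mem' := by
    rintro c x ⟨f, hf, hf'⟩
    exact ⟨c • f, A.calderon.smul_mem c hf, P.smul_mem c hf'⟩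

/-- The condition `f θ = a`. -/
def valueAt (θ : ℝ) : Submodule ℂ ((ℂ → A.Sum) × A.Sum) where
  carrier := {x | x.1 θ = x.2}
  zero_mem' := by simp
  add_mem' := fun {x y} hx hy => by simp_all
  smul_mem' := fun c x hx => by simp_all

/-- The condition `f' θ = a`. -/
def derivAt (θ : ℝ) : Submodule ℂ ((ℂ → A.Sum) × A.Sum) where
  carrier := {x | HasDerivAt x.1 x.2 (θ : ℂ)}
  zero_mem' := hasDerivAt_const _ _
  add_mem' := fun {_ _} hx hy => HasDerivAt.add hx hy
  smul_mem' := fun c _ hx => HasDerivAt.const_smul c hx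

/-- The condition `f θ = a`, `f' θ = 0`. -/
def flatAt (θ : ℝ) : Submodule ℂ ((ℂ → A.Sum) × A.Sum) where
  carrier := {x | x.1 θ = x.2 ∧ HasDerivAt x.1 0 (θ : ℂ)}
  zero_mem' := ⟨rfl, hasDerivAt_const _ _⟩
  add_mem' := fun {x y} hx hy => ⟨by simp_all, by simpa using HasDerivAt.add hx.2 hy.2⟩
  smul_mem' := fun c x hx => ⟨by simp_all, by simpa using HasDerivAt.const_smul c hx.2⟩

/-! ### The interpolation norms and the endpoint norms -/

/-- `‖a‖_θ = inf {‖f‖ : f ∈ 𝓕, f θ = a}`. -/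
def normTheta (θ : ℝ) : ExtSeminorm A.Sum := ExtSeminorm.ofRel (A.boundaryRel (A.valueAt θ))

/-- `‖a‖_{δ'(θ)} = inf {‖f‖ : f ∈ 𝓕, f' θ = a}`. -/
def normLower (θ : ℝ) : ExtSeminorm A.Sum := ExtSeminorm.ofRel (A.boundaryRel (A.derivAt θ))

/-- `‖a‖^{δ'(θ)} = inf {‖f‖ : f ∈ 𝓕, f θ = a, f' θ = 0}`. -/
def normUpper (θ : ℝ) : ExtSeminorm A.Sum := ExtSeminorm.ofRel (A.boundaryRel (A.flatAt θ))

/-- `‖a‖_{δ(0)} = limsup_{θ → 0⁺} ‖a‖_θ`. -/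
def endpoint : ExtSeminorm A.Sum := ExtSeminorm.limsupZero (fun _ => 1) A.normTheta

/-- `‖a‖_{δ'(0)} = limsup_{θ → 0⁺} ‖a‖_{δ'(θ)} / θ`. -/
def endpointLower : ExtSeminorm A.Sum :=
  ExtSeminorm.limsupZero (fun θ => (ENNReal.ofReal θ)⁻¹) A.normLower

/-- `‖a‖^{δ'(0)} = limsup_{θ → 0⁺} ‖a‖^{δ'(θ)}`. -/
def endpointUpper : ExtSeminorm A.Sum := ExtSeminorm.limsupZero (fun _ => 1) A.normUpper

end CompatibleCouple

/-! ### Analytic families of operators on the right half-plane -/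

variable {A B : CompatibleCouple} {D : Submodule ℂ A.Inter}

/-- The inclusion into `A₀ + A₁` of a subspace `D` of `A₀ ∩ A₁`. -/
def inclOf (D : Submodule ℂ A.Inter) : D →ₗ[ℂ] A.Sum := A.inclInter ∘ₗ D.subtype

/-- The family `T_ξ : D → B₀ + B₁`, `Re ξ ≥ 0`, is analytic: for every `d` the function `T_ξ d` is
weakly continuous on `Re ξ ≥ 0` and weakly holomorphic in `Re ξ > 0`, it is `B₀`-continuous on the
line `Re ξ = 0`, and `B₁`-continuous on each line `Re ξ = α > 0`. -/
structure IsAnalyticFamily (T : ℂ → D →ₗ[ℂ] B.Sum) : Prop where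
  continuousOn : ∀ (d : D) (l : StrongDual ℂ B.Sum),
    ContinuousOn (fun ξ => l (T ξ d)) {ξ | 0 ≤ ξ.re}
  differentiableOn : ∀ (d : D) (l : StrongDual ℂ B.Sum),
    DifferentiableOn ℂ (fun ξ => l (T ξ d)) {ξ | 0 < ξ.re}
  continuous₀ : ∀ d : D, ∃ g : ℝ → B.X₀, Continuous g ∧
    ∀ t : ℝ, T (t * Complex.I) d = B.incl₀ (g t)
  continuous₁ : ∀ (d : D) (α : ℝ), 0 < α → ∃ g : ℝ → B.X₁, Continuous g ∧
    ∀ t : ℝ, T (α + t * Complex.I) d = B.incl₁ (g t)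

/-- `T_{it} : (D, ‖·‖_{A₀}) → B₀` has norm at most `M₀ exp (C |t| ^ s)` for all real `t`, and
`T_{α + it} : (D, ‖·‖_{A₁}) → B₁` has norm at most `M₁ M ^ α exp (C |t| ^ s)` for all real `t` and
all `α > 0`. -/
structure HasGrowth (T : ℂ → D →ₗ[ℂ] B.Sum) (M₀ M₁ M C s : ℝ) : Prop where
  bound₀ : ∀ (t : ℝ) (d : D), ∃ b : B.X₀, T (t * Complex.I) d = B.incl₀ b ∧
    ‖b‖ ≤ M₀ * Real.exp (C * |t| ^ s) * ‖d.1.1.1‖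
  bound₁ : ∀ (t α : ℝ), 0 < α → ∀ d : D, ∃ b : B.X₁, T (α + t * Complex.I) d = B.incl₁ b ∧
    ‖b‖ ≤ M₁ * M ^ α * Real.exp (C * |t| ^ s) * ‖d.1.1.2‖

end

/-! Fix a small θ and rescale by ξ = z / θ, so that z = θ corresponds to ξ = 1. If f ∈ 𝓕(A₀, A₁) has
f(θ) = d, the natural competitor for T₁ d is z ↦ Φ(z) T_{z/θ} f(z), where the scalar function Φ,
with Φ(θ) = 1, absorbs the growth of the family. Three points carry the proof.

Damping (`exists_stripDamping`). In w = z / θ, take the exponential of (C / cos(π s / 2)) (1 - w ^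
s) + (1 - w) L with L = log M + θ log M₁. For s < 1 the cosine is positive and Re w ^ s ≥ cos(π s /
2) |Im w| ^ s on the half-plane, so the first term beats exp(C |t| ^ s); the second removes M ^ α
and M₁. The price of the normalization at w = 1 involves M₁ only through M₁ ^ θ, which is at most e
once θ log M₁ ≤ 1. This is why M₁ disappears as θ → 0. A bounded rational factor also makes Φ'(θ) =
0.

Approximation (`incl₀_fourier_eq`, `exists_simpleMaps_approx`). The operators act only on D, so f
has to be replaced by a D-valued function with exactly the same value (and derivative) at θ. The
function f - d vanishes at θ to order n = 1 or 2. Divide it by (z - θ) ^ n and multiply by a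
Gaussian. By Cauchy's theorem the Fourier integrals over the two edges agree up to the factor
exp(-2πv), hence lie in A₀ ∩ A₁, where D is dense. Gaussian means of the inverse Fourier integral
recover the boundary functions uniformly, and multiplying back by (z - θ) ^ n keeps the order of
vanishing.

Derivatives (`normLower_family_le`). The derivative of T_{z/θ} F(z) at θ is θ⁻¹ T₁' F(θ) + T₁ F'(θ).
The condition F'(θ) = 0 removes the second term, and multiplication by θ explains the weight 1 / θ
in ‖·‖_{δ'(0)}.

For s = 1 the scalar functions y ^ ξ ξ ^ (-ξ) are bounded by exp(π |t| / 2) on the imaginary axis,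
uniformly in y, and by exp(y) exp(π |t| / 2) on the half-plane, yet equal y at ξ = 1. With y = n + 1
as diagonal entries on ℓ¹, and the factor exp(y) put into the weight of the second target space, T₁
is unbounded, because the endpoint norm of the target still dominates every coordinate. -/

section

open MeasureTheory
open scoped FourierTransform RealInnerProductSpace

/-! ### Weak holomorphy, and contour shifts across the strip -/

theorem exists_lipschitzOn_of_differentiableOn {f : ℂ → ℂ} {U : Set ℂ} (hU : IsOpen U)
    (hf : DifferentiableOn ℂ f U) {c : ℂ} {r : ℝ} (hr : Metric.closedBall c r ⊆ U) :
    ∃ C : ℝ, ∀ x ∈ Metric.closedBall c r, ∀ y ∈ Metric.closedBall c r,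
      ‖f x - f y‖ ≤ C * ‖x - y‖ := by
  obtain ⟨C, hC⟩ := (isCompact_closedBall c r).exists_bound_of_continuousOn
    ((hf.deriv hU).continuousOn.mono hr)
  refine ⟨C, fun x hx y hy => (convex_closedBall c r).norm_image_sub_le_of_norm_deriv_le
    (fun z hz => hf.differentiableAt (hU.mem_nhds (hr hz))) hC hy hx⟩

/-- A weakly holomorphic function with values in a Banach space is holomorphic. -/
theorem differentiableAt_of_forall_dual {E : Type*} [NormedAddCommGroup E] [NormedSpace ℂ E]
    [CompleteSpace E] {f : ℂ → E} {U : Set ℂ} (hU : IsOpen U) {c : ℂ} (hc : c ∈ U)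
    (hf : ∀ l : StrongDual ℂ E, DifferentiableOn ℂ (fun z => l (f z)) U) :
    DifferentiableAt ℂ f c := by
  obtain ⟨r, hr0, hr⟩ := Metric.nhds_basis_closedBall.mem_iff.1 (hU.mem_nhds hc)
  let S : Set ℂ := Metric.closedBall c r \ {c}
  let ι := {p : ℂ × ℂ // p.1 ∈ S ∧ p.2 ∈ S}
  let g : ι → StrongDual ℂ E →L[ℂ] ℂ := fun p => NormedSpace.inclusionInDoubleDual ℂ E
    ((p.1.1 - p.1.2)⁻¹ • (slope f c p.1.1 - slope f c p.1.2))
  have hs : ∀ (l : StrongDual ℂ E) (z : ℂ), z ≠ c →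
      l (slope f c z) = dslope (fun z => l (f z)) c z := fun l z hz => by
    rw [dslope_of_ne _ hz]
    simp [slope_def_module]
  -- For each functional the scalar slopes are Lipschitz near c. Uniform boundedness gives one
  -- constant for all functionals, so the vector slope is Lipschitz off c and converges by
  -- completeness.
  obtain ⟨C, hC⟩ : ∃ C, ∀ p, ‖g p‖ ≤ C := by
    refine banach_steinhaus fun l => ?_
    obtain ⟨C, hC⟩ := exists_lipschitzOn_of_differentiableOn hU
      ((Complex.differentiableOn_dslope (hU.mem_nhds hc)).2 (hf l)) hr
    refine ⟨|C|, fun p => ?_⟩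
    have h1 : g p l = (p.1.1 - p.1.2)⁻¹ * (dslope (fun z => l (f z)) c p.1.1 -
        dslope (fun z => l (f z)) c p.1.2) := by
      change l ((p.1.1 - p.1.2)⁻¹ • (slope f c p.1.1 - slope f c p.1.2)) = _
      rw [map_smul, map_sub, hs l _ p.2.1.2, hs l _ p.2.2.2, smul_eq_mul]
    rw [h1, norm_mul, norm_inv]
    rcases eq_or_ne p.1.1 p.1.2 with h | h
    · simp [h]
    have h2 : 0 < ‖p.1.1 - p.1.2‖ := norm_pos_iff.2 (sub_ne_zero.2 h)
    rw [inv_mul_le_iff₀ h2]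
    refine (hC _ p.2.1.1 _ p.2.2.1).trans ?_
    rw [mul_comm]
    exact mul_le_mul_of_nonneg_left (le_abs_self C) h2.le
  have hlip : ∀ x ∈ S, ∀ y ∈ S, ‖slope f c x - slope f c y‖ ≤ C * ‖x - y‖ := by
    intro x hx y hy
    rcases eq_or_ne x y with h | h
    · simp [h]
    have h1 := hC ⟨(x, y), hx, hy⟩
    have h2 : ‖g ⟨(x, y), hx, hy⟩‖ = ‖(x - y)⁻¹ • (slope f c x - slope f c y)‖ :=
      (NormedSpace.inclusionInDoubleDualLi ℂ (E := E)).norm_map _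
    have h3 : 0 < ‖x - y‖ := norm_pos_iff.2 (sub_ne_zero.2 h)
    rwa [h2, norm_smul, norm_inv, inv_mul_le_iff₀ h3, mul_comm] at h1
  have hL : LipschitzOnWith C.toNNReal (slope f c) S := by
    refine LipschitzOnWith.of_dist_le_mul fun x hx y hy => ?_
    rw [dist_eq_norm, dist_eq_norm]
    exact (hlip x hx y hy).trans
      (mul_le_mul_of_nonneg_right (Real.le_coe_toNNReal C) (norm_nonneg _))
  have hS : S ∈ 𝓝[≠] c := by
    rw [mem_nhdsWithin]
    exact ⟨Metric.ball c r, Metric.isOpen_ball, Metric.mem_ball_self hr0,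
      fun x hx => ⟨Metric.ball_subset_closedBall hx.1, hx.2⟩⟩
  have hcauchy : Cauchy (map (slope f c) (𝓝[≠] c)) := by
    have h1 : Cauchy (𝓝[≠] c) := cauchy_nhds.mono nhdsWithin_le_nhds
    exact h1.map_of_le hL.uniformContinuousOn (le_principal_iff.2 hS)
  obtain ⟨a, ha⟩ := CompleteSpace.complete hcauchy
  exact (hasDerivAt_iff_tendsto_slope.2 ha).differentiableAt

/-- The integrals over the two edges of the strip of a holomorphic function of Gaussian decay
agree. -/
theorem integral_strip_edges_eq {k : ℂ → ℂ} {C : ℝ}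
    (hc : ContinuousOn k {z | 0 ≤ z.re ∧ z.re ≤ 1})
    (hd : DifferentiableOn ℂ k {z | 0 < z.re ∧ z.re < 1})
    (hb : ∀ z : ℂ, 0 ≤ z.re → z.re ≤ 1 → 1 ≤ |z.im| → ‖k z‖ ≤ C * Real.exp (-|z.im|))
    (h0 : Integrable fun t : ℝ => k (t * Complex.I))
    (h1 : Integrable fun t : ℝ => k (1 + t * Complex.I)) :
    ∫ t : ℝ, k (t * Complex.I) = ∫ t : ℝ, k (1 + t * Complex.I) := by
  have hrect : ∀ n : ℝ, 0 < n →
      (∫ x : ℝ in (0 : ℝ)..1, k (x + (-n : ℝ) * Complex.I)) -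
        (∫ x : ℝ in (0 : ℝ)..1, k (x + (n : ℝ) * Complex.I)) +
        Complex.I • (∫ y : ℝ in (-n)..n, k (1 + y * Complex.I)) -
        Complex.I • (∫ y : ℝ in (-n)..n, k (y * Complex.I)) = 0 := by
    intro n hn
    have := Complex.integral_boundary_rect_eq_zero_of_continuousOn_of_differentiableOn k
      (⟨0, -n⟩ : ℂ) (⟨1, n⟩ : ℂ) (hc.mono ?_) (hd.mono ?_)
    · simpa using this
    · intro z hz
      have := hz.1
      simpa using this
    · intro z hz
      have := hz.1
      simpa using this
  -- The horizontal sides, at the heights ±n, are bounded by C exp(-n).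
  have hhor : ∀ σ : ℝ, |σ| = 1 → Tendsto (fun n : ℝ =>
      ∫ x : ℝ in (0 : ℝ)..1, k (x + (σ * n : ℝ) * Complex.I)) atTop (𝓝 0) := by
    intro σ hσ
    have hlim : Tendsto (fun n : ℝ => C * Real.exp (-n) * |1 - 0|) atTop (𝓝 0) := by
      simpa using (Real.tendsto_exp_neg_atTop_nhds_zero.const_mul C)
    refine squeeze_zero_norm' ?_ hlim
    filter_upwards [eventually_ge_atTop 1] with n hn
    refine intervalIntegral.norm_integral_le_of_norm_le_const fun x hx => ?_
    rw [uIoc_of_le zero_le_one] at hx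
    have h2 : |σ * n| = n := by rw [abs_mul, hσ, one_mul, abs_of_nonneg (by linarith)]
    have := hb (x + (σ * n : ℝ) * Complex.I) (by simpa using hx.1.le) (by simpa using hx.2)
      (by simpa [h2] using hn)
    simpa [h2] using this
  have e0 := intervalIntegral_tendsto_integral h0 tendsto_neg_atTop_atBot tendsto_id
  have e1 := intervalIntegral_tendsto_integral h1 tendsto_neg_atTop_atBot tendsto_id
  have e2 := (((hhor (-1) (by simp)).sub (hhor 1 (by simp))).add (e1.const_smul Complex.I)).sub
    (e0.const_smul Complex.I)
  have e3 : Tendsto (fun _ : ℝ => (0 : ℂ)) atTop (𝓝 0) := tendsto_const_nhds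
  have e4 := tendsto_nhds_unique (e2.congr' ?_) e3
  · rw [sub_self, zero_add, sub_eq_zero] at e4
    simpa using e4.symm
  · filter_upwards [eventually_gt_atTop 0] with n hn
    simpa using hrect n hn

/-! ### Gaussian means of the inverse Fourier integral -/

/-- The multiplication formula ∫ G · 𝓕 H = ∫ 𝓕 G · H for a modulated Gaussian G, whose Fourier
transform is a Gaussian centred at t. -/
theorem integral_gaussian_fourier {E : Type*} [NormedAddCommGroup E] [NormedSpace ℂ E]
    [CompleteSpace E] {H : ℝ → E} (hH : Integrable H) {b : ℝ} (hb : 0 < b) (t : ℝ) :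
    ∫ v : ℝ, Complex.exp (-b * v ^ 2 + 2 * Real.pi * t * v * Complex.I) • 𝓕 H v =
      ∫ u : ℝ, (√(Real.pi / b) * Real.exp (-(Real.pi ^ 2 / b) * (t - u) ^ 2)) • H u := by
  have J : Integrable fun v : ℝ =>
      Complex.exp (-(b : ℂ) * ‖v‖ ^ 2 + 2 * Real.pi * Complex.I * ⟪t, v⟫) :=
    GaussianFourier.integrable_cexp_neg_mul_sq_norm_add (by simpa) _ _
  have h := VectorFourier.integral_fourierIntegral_smul_eq_flip (L := innerₗ ℝ)
    Real.continuous_fourierChar continuous_inner J hH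
  have h2 : ∀ u : ℝ, 𝓕 (fun v : ℝ =>
      Complex.exp (-(b : ℂ) * ‖v‖ ^ 2 + 2 * Real.pi * Complex.I * ⟪t, v⟫)) u =
      ((√(Real.pi / b) * Real.exp (-(Real.pi ^ 2 / b) * (t - u) ^ 2) : ℝ) : ℂ) := by
    intro u
    have hsq : ((‖t - u‖ : ℝ) : ℂ) ^ 2 = ((t - u) ^ 2 : ℝ) := by
      rw [← Complex.ofReal_pow, Real.norm_eq_abs, sq_abs]
    rw [fourier_gaussian_innerProductSpace' (by simpa), Real.sqrt_eq_rpow, Complex.ofReal_mul,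
      Complex.ofReal_cpow (by positivity), Complex.ofReal_exp, hsq]
    simp only [Module.finrank_self, Nat.cast_one]
    push_cast
    congr 2
    ring
  have h3 : ∫ v : ℝ, Complex.exp (-(b : ℂ) * ‖v‖ ^ 2 + 2 * Real.pi * Complex.I * ⟪t, v⟫) • 𝓕 H v =
      ∫ u : ℝ, 𝓕 (fun v : ℝ =>
        Complex.exp (-(b : ℂ) * ‖v‖ ^ 2 + 2 * Real.pi * Complex.I * ⟪t, v⟫)) u • H u := by
    simpa using! h.symm
  simp_rw [h2] at h3
  have h4 : ∀ v : ℝ, Complex.exp (-b * v ^ 2 + 2 * Real.pi * t * v * Complex.I) =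
      Complex.exp (-(b : ℂ) * ‖v‖ ^ 2 + 2 * Real.pi * Complex.I * ⟪t, v⟫) := by
    intro v
    have hsq : ((‖v‖ : ℝ) : ℂ) ^ 2 = (v : ℂ) ^ 2 := by
      rw [← Complex.ofReal_pow, Real.norm_eq_abs, sq_abs, Complex.ofReal_pow]
    rw [hsq]
    congr 1
    simp only [RCLike.inner_apply, conj_trivial]
    push_cast
    ring
  simp_rw [h4, h3]
  exact integral_congr_ae (Eventually.of_forall fun u => Complex.coe_smul _ _)

/-- The mean is an average of H against a probability density centred at t with variance of order b,
so a modulus of continuity quadratic in t - u averages to ε plus a multiple of b. -/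
theorem norm_gaussian_average_sub_le {E : Type*} [NormedAddCommGroup E] [NormedSpace ℂ E]
    [CompleteSpace E] {H : ℝ → E} (hH : Integrable H) {ε c : ℝ} (hc0 : 0 ≤ c)
    (hc : ∀ t u, ‖H u - H t‖ ≤ ε + c * (t - u) ^ 2) {b : ℝ} (hb : 0 < b) (t : ℝ) :
    ‖(∫ v : ℝ, Complex.exp (-b * v ^ 2 + 2 * Real.pi * t * v * Complex.I) • 𝓕 H v) - H t‖ ≤
      ε + c * b := by
  rw [integral_gaussian_fourier hH hb]
  have hpi := Real.pi_pos
  have hint : ∀ a : ℝ, 0 < a → Integrable fun u : ℝ => Real.exp (-a * (t - u) ^ 2) := fun a ha =>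
    (integrable_exp_neg_mul_sq ha).comp_sub_left t
  have hval : ∀ a : ℝ, ∫ u : ℝ, Real.exp (-a * (t - u) ^ 2) = √(Real.pi / a) := fun a => by
    rw [← integral_gaussian a]
    exact integral_sub_left_eq_self (fun x : ℝ => Real.exp (-a * x ^ 2)) _ t
  set a := Real.pi ^ 2 / b with ha
  have ha0 : 0 < a := by positivity
  set w := √(Real.pi / b) with hw
  have hw0 : 0 ≤ w := Real.sqrt_nonneg _
  have hwa : w * √(Real.pi / a) = 1 := by
    rw [hw, ← Real.sqrt_mul (by positivity), ha]
    rw [show Real.pi / b * (Real.pi / (Real.pi ^ 2 / b)) = 1 by field_simp]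
    simp
  have hmass : ∫ u : ℝ, w * Real.exp (-a * (t - u) ^ 2) = 1 := by
    rw [integral_const_mul, hval, hwa]
  have hint1 : Integrable fun u : ℝ => w * Real.exp (-a * (t - u) ^ 2) := (hint a ha0).const_mul w
  have hintH : Integrable fun u : ℝ => (w * Real.exp (-a * (t - u) ^ 2)) • H u := by
    refine Integrable.bdd_smul (𝕜 := ℝ) (φ := fun u : ℝ => w * Real.exp (-a * (t - u) ^ 2))
      (C := w) hH ?_ ?_
    · exact Continuous.aestronglyMeasurable (by fun_prop)
    · refine Eventually.of_forall fun u => ?_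
      rw [Real.norm_of_nonneg (by positivity)]
      refine mul_le_of_le_one_right hw0 (Real.exp_le_one_iff.2 ?_)
      nlinarith [sq_nonneg (t - u)]
  have e1 : H t = ∫ u : ℝ, (w * Real.exp (-a * (t - u) ^ 2)) • H t := by
    rw [integral_smul_const, hmass, one_smul]
  have e2 : ∀ u : ℝ, ‖(w * Real.exp (-a * (t - u) ^ 2)) • (H u - H t)‖ ≤
      ε * (w * Real.exp (-a * (t - u) ^ 2)) +
        (c * (2 / a)) * (w * Real.exp (-(a / 2) * (t - u) ^ 2)) := by
    intro u
    rw [norm_smul, Real.norm_of_nonneg (by positivity)]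
    set r := (t - u) ^ 2 with hr
    have hr0 : 0 ≤ r := sq_nonneg _
    -- Half of the exponent is given up to absorb r. The remaining half has total mass √2, and 2√2 /
    -- π² ≤ 1 yields the clean bound b at the end.
    have h1 : r * Real.exp (-a * r) ≤ 2 / a * Real.exp (-(a / 2) * r) := by
      have h2 : a / 2 * r ≤ Real.exp (a / 2 * r) := by
        linarith [Real.add_one_le_exp (a / 2 * r)]
      have h3 : Real.exp (-(a / 2) * r) = Real.exp (a / 2 * r) * Real.exp (-a * r) := by
        rw [← Real.exp_add]; ring_nf
      rw [h3, ← mul_assoc]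
      refine mul_le_mul_of_nonneg_right ?_ (Real.exp_pos _).le
      rw [div_mul_eq_mul_div, le_div_iff₀ ha0]
      linarith
    calc w * Real.exp (-a * r) * ‖H u - H t‖ ≤ w * Real.exp (-a * r) * (ε + c * r) :=
          mul_le_mul_of_nonneg_left (hc t u) (by positivity)
      _ = ε * (w * Real.exp (-a * r)) + c * w * (r * Real.exp (-a * r)) := by ring
      _ ≤ ε * (w * Real.exp (-a * r)) + c * w * (2 / a * Real.exp (-(a / 2) * r)) := by gcongr
      _ = _ := by ring
  have hint2 : Integrable fun u : ℝ => ε * (w * Real.exp (-a * (t - u) ^ 2)) +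
        (c * (2 / a)) * (w * Real.exp (-(a / 2) * (t - u) ^ 2)) :=
    (hint1.const_mul ε).add (((hint (a / 2) (by positivity)).const_mul w).const_mul _)
  conv_lhs => rw [e1]
  rw [← integral_sub hintH (hint1.smul_const _)]
  simp_rw [← smul_sub]
  refine (norm_integral_le_of_norm_le hint2 (Eventually.of_forall e2)).trans ?_
  rw [integral_add (hint1.const_mul ε)
    (((hint (a / 2) (by positivity)).const_mul w).const_mul _), integral_const_mul, hmass,
    integral_const_mul, integral_const_mul, hval]
  have h5 : √(Real.pi / (a / 2)) = √2 * √(Real.pi / a) := by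
    rw [← Real.sqrt_mul (by positivity)]
    congr 1
    field_simp
  have h6 : w * √(Real.pi / (a / 2)) = √2 := by rw [h5, mul_left_comm, hwa, mul_one]
  rw [h6, mul_one, mul_assoc]
  have h7 : 2 / a * √2 ≤ b := by
    have h8 : √2 ≤ 2 := by
      rw [Real.sqrt_le_left (by norm_num)]; norm_num
    have h9 : 2 / a = 2 * b / Real.pi ^ 2 := by rw [ha]; field_simp
    rw [h9, div_mul_eq_mul_div, div_le_iff₀ (by positivity)]
    have h10 : 4 ≤ Real.pi ^ 2 := by nlinarith [Real.pi_gt_three]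
    nlinarith
  gcongr

/-- A function vanishing at infinity is the uniform limit of the Gaussian means of its Fourier
integral. -/
theorem eventually_norm_gaussian_average_sub_le {E : Type*} [NormedAddCommGroup E]
    [NormedSpace ℂ E] [CompleteSpace E] {H : ℝ → E} (hH : Integrable H) (hcont : Continuous H)
    (hlim : Tendsto H (cocompact ℝ) (𝓝 0)) {ε : ℝ} (hε : 0 < ε) :
    ∀ᶠ b : ℝ in 𝓝[>] (0 : ℝ), ∀ t : ℝ,
      ‖(∫ v : ℝ, Complex.exp (-b * v ^ 2 + 2 * Real.pi * t * v * Complex.I) • 𝓕 H v) - H t‖ ≤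
        ε := by
  have huc := hcont.uniformContinuous_of_tendsto_cocompact hlim
  obtain ⟨δ, hδ, hδ'⟩ := Metric.uniformContinuous_iff.1 huc (ε / 2) (by positivity)
  obtain ⟨B, hB⟩ : ∃ B, ∀ t, ‖H t‖ ≤ B := by
    obtain ⟨B, hB⟩ := (ZeroAtInftyContinuousMap.isBounded_range
      (⟨⟨H, hcont⟩, hlim⟩ : ZeroAtInftyContinuousMap ℝ E)).exists_norm_le
    exact ⟨B, fun t => hB _ ⟨t, rfl⟩⟩
  have hB0 : 0 ≤ B := (norm_nonneg _).trans (hB 0)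
  -- With this c the quadratic term exceeds the trivial bound 2B as soon as |t - u| ≥ δ; closer
  -- points are covered by uniform continuity.
  set c := 2 * B / δ ^ 2 with hc
  have hc0 : 0 ≤ c := by positivity
  have hmod : ∀ t u, ‖H u - H t‖ ≤ ε / 2 + c * (t - u) ^ 2 := by
    intro t u
    rcases lt_or_ge |t - u| δ with h | h
    · have := hδ' (a := u) (b := t) (by rwa [Real.dist_eq, abs_sub_comm])
      rw [dist_eq_norm] at this
      have h2 : 0 ≤ c * (t - u) ^ 2 := by positivity
      linarith
    · have h1 : ‖H u - H t‖ ≤ 2 * B := (norm_sub_le _ _).trans (by linarith [hB u, hB t])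
      have h2 : δ ^ 2 ≤ (t - u) ^ 2 := by rw [← sq_abs (t - u)]; gcongr
      have h3 : 2 * B ≤ c * (t - u) ^ 2 := by
        rw [hc, div_mul_eq_mul_div, le_div_iff₀ (by positivity)]
        gcongr
      linarith
  have hev : ∀ᶠ b in 𝓝[>] (0 : ℝ), c * b < ε / 2 := by
    have : Tendsto (fun b : ℝ => c * b) (𝓝[>] 0) (𝓝 (c * 0)) :=
      (tendsto_id.mono_left nhdsWithin_le_nhds).const_mul c
    rw [mul_zero] at this
    exact this.eventually_lt_const (by positivity)
  filter_upwards [hev, self_mem_nhdsWithin] with b hb hb0 t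
  refine (norm_gaussian_average_sub_le hH hc0 hmod hb0 t).trans ?_
  linarith

/-! ### Weights and densities on the edges of the strip -/

/-- The Gaussian `exp ((z - θ) ^ 2)`. -/
noncomputable def gaussAt (θ : ℝ) (z : ℂ) : ℂ := Complex.exp ((z - θ) ^ 2)

theorem norm_gaussAt (θ : ℝ) (z : ℂ) :
    ‖gaussAt θ z‖ = Real.exp ((z.re - θ) ^ 2 - z.im ^ 2) := by
  rw [gaussAt, Complex.norm_exp]
  simp [sq]

theorem differentiable_gaussAt (θ : ℝ) : Differentiable ℂ (gaussAt θ) := by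
  unfold gaussAt
  fun_prop

theorem continuous_gaussAt (θ : ℝ) : Continuous (gaussAt θ) := (differentiable_gaussAt θ).continuous

theorem gaussAt_self (θ : ℝ) : gaussAt θ θ = 1 := by simp [gaussAt]

theorem norm_gaussAt_le {θ : ℝ} {z : ℂ} (h : |z.re - θ| ≤ 1) :
    ‖gaussAt θ z‖ ≤ Real.exp (1 - z.im ^ 2) := by
  rw [norm_gaussAt, Real.exp_le_exp]
  have := (sq_le_one_iff_abs_le_one _).2 h
  linarith

theorem one_add_abs_pow_mul_exp_le (m : ℕ) (t : ℝ) :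
    (1 + |t|) ^ m * Real.exp (1 - t ^ 2) ≤ m.factorial * Real.exp 3 := by
  have h1 : (1 + |t|) ^ m ≤ m.factorial * Real.exp (1 + |t|) := by
    have := Real.pow_div_factorial_le_exp (x := 1 + |t|) (by positivity) m
    rwa [div_le_iff₀ (by positivity), mul_comm] at this
  calc _ ≤ m.factorial * Real.exp (1 + |t|) * Real.exp (1 - t ^ 2) := by gcongr
    _ = m.factorial * Real.exp (1 + |t| + (1 - t ^ 2)) := by
        rw [mul_assoc, ← Real.exp_add]
    _ ≤ _ := by
      gcongr
      rw [← sq_abs]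
      nlinarith [sq_nonneg (|t| - 1), abs_nonneg t]

theorem norm_pow_mul_gaussAt_le {θ : ℝ} {z : ℂ} (h : |z.re - θ| ≤ 1) (n : ℕ) :
    ‖(z - θ) ^ n * gaussAt θ z‖ ≤ (1 + |z.im|) ^ n * Real.exp (1 - z.im ^ 2) := by
  rw [norm_mul, norm_pow]
  have : ‖z - θ‖ ≤ 1 + |z.im| := by
    refine (Complex.norm_le_abs_re_add_abs_im _).trans ?_
    simpa using h
  gcongr
  exact norm_gaussAt_le h

theorem norm_exp_mul_I_sub_le (x y : ℝ) :
    ‖Complex.exp (x * Complex.I) - Complex.exp (y * Complex.I)‖ ≤ |x - y| := by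
  have : Complex.exp (x * Complex.I) - Complex.exp (y * Complex.I) =
      Complex.exp (y * Complex.I) * (Complex.exp (Complex.I * (x - y : ℝ)) - 1) := by
    rw [mul_sub, ← Complex.exp_add, mul_one]
    congr 2
    push_cast
    ring
  rw [this, norm_mul, Complex.norm_exp_ofReal_mul_I, one_mul]
  exact Real.norm_exp_I_mul_ofReal_sub_one_le

/-- The function `(z - θ) ^ n exp ((z - θ) ^ 2) exp (2 π v (z - c))` on the line `Re z = c`. -/
noncomputable def edgeWeight (θ : ℝ) (n : ℕ) (c : ℝ) (hc : |c - θ| ≤ 1) (v : ℝ) : ℝ →ᵇ ℂ :=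
  BoundedContinuousFunction.ofNormedAddCommGroup
    (fun t => (c + t * Complex.I - θ) ^ n * gaussAt θ (c + t * Complex.I) *
      Complex.exp ((2 * Real.pi * v * t : ℝ) * Complex.I))
    (by have := continuous_gaussAt θ; fun_prop) (n.factorial * Real.exp 3)
    (fun t => by
      rw [norm_mul, Complex.norm_exp_ofReal_mul_I, mul_one]
      refine (norm_pow_mul_gaussAt_le (by simpa using hc) n).trans ?_
      simpa using one_add_abs_pow_mul_exp_le n t)

theorem continuous_const_bcf {X : Type*} [NormedAddCommGroup X] : Continuous fun x : X => BoundedContinuousFunction.const ℝ x :=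
  (LipschitzWith.of_dist_le_mul (K := 1) fun x y => by
    simpa using (BoundedContinuousFunction.dist_le dist_nonneg).2 fun _ => le_rfl).continuous

section Edge

variable {θ : ℝ} {n : ℕ} {c : ℝ} (hc : |c - θ| ≤ 1)

theorem edgeWeight_apply (v t : ℝ) : edgeWeight θ n c hc v t =
    (c + t * Complex.I - θ) ^ n * gaussAt θ (c + t * Complex.I) *
      Complex.exp ((2 * Real.pi * v * t : ℝ) * Complex.I) := rfl

theorem norm_edgeWeight_le (v : ℝ) : ‖edgeWeight θ n c hc v‖ ≤ n.factorial * Real.exp 3 :=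
  BoundedContinuousFunction.norm_ofNormedAddCommGroup_le _ (by positivity) _

/-- Varying v costs a factor 2π |t|, which the Gaussian absorbs at the price of one more power of 1
+ |t|. Hence the weights are even Lipschitz in v for the sup norm, and the densities below are
continuous. -/
theorem continuous_edgeWeight : Continuous (edgeWeight θ n c hc) := by
  refine (LipschitzWith.of_dist_le_mul
    (K := (2 * Real.pi * ((n + 1).factorial * Real.exp 3)).toNNReal) fun v w => ?_).continuous
  rw [Real.coe_toNNReal _ (by positivity)]
  refine (BoundedContinuousFunction.dist_le (by positivity)).2 fun t => ?_
  rw [dist_eq_norm, edgeWeight_apply, edgeWeight_apply, ← mul_sub, norm_mul]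
  have h1 := norm_pow_mul_gaussAt_le (z := c + t * Complex.I) (by simpa using hc) n
  have h2 := norm_exp_mul_I_sub_le (2 * Real.pi * v * t) (2 * Real.pi * w * t)
  have h3 : |2 * Real.pi * v * t - 2 * Real.pi * w * t| = 2 * Real.pi * |v - w| * |t| := by
    rw [← abs_of_pos Real.two_pi_pos, ← abs_mul, ← abs_mul, abs_of_pos Real.two_pi_pos]
    ring_nf
  rw [h3] at h2
  have h4 := one_add_abs_pow_mul_exp_le (n + 1) t
  simp only [Complex.add_im, Complex.ofReal_im, Complex.mul_im, Complex.ofReal_re, Complex.I_im,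
    mul_one, Complex.I_re, mul_zero, add_zero, zero_add] at h1
  rw [Real.dist_eq]
  calc _ ≤ ((1 + |t|) ^ n * Real.exp (1 - t ^ 2)) * (2 * Real.pi * |v - w| * |t|) := by gcongr
    _ ≤ ((1 + |t|) ^ n * Real.exp (1 - t ^ 2)) * (2 * Real.pi * |v - w| * (1 + |t|)) := by
      gcongr; linarith
    _ = 2 * Real.pi * |v - w| * ((1 + |t|) ^ (n + 1) * Real.exp (1 - t ^ 2)) := by ring
    _ ≤ 2 * Real.pi * |v - w| * ((n + 1).factorial * Real.exp 3) := by gcongr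
    _ = _ := by ring

variable {X : Type*} [NormedAddCommGroup X] [NormedSpace ℂ X]

/-- The function `(z - θ) ^ (-n) exp ((z - θ) ^ 2) g` on the line `Re z = c`. -/
noncomputable def edgeQuotient (θ : ℝ) (n : ℕ) (c : ℝ) (g : ℝ →ᵇ X) (t : ℝ) : X :=
  (((c + t * Complex.I - θ) ^ n)⁻¹ * gaussAt θ (c + t * Complex.I)) • g t

theorem edge_sub_ne_zero (hcθ : c ≠ θ) (t : ℝ) : (c + t * Complex.I - θ : ℂ) ≠ 0 := by
  intro h
  have := congrArg Complex.re h
  simp at this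
  exact hcθ (by linarith)

theorem continuous_edgeQuotient (hcθ : c ≠ θ) (g : ℝ →ᵇ X) :
    Continuous (edgeQuotient θ n c g) := by
  unfold edgeQuotient
  have := continuous_gaussAt θ
  have h2 : Continuous fun t : ℝ => ((c + t * Complex.I - θ : ℂ) ^ n)⁻¹ :=
    Continuous.inv₀ (by fun_prop) fun t => pow_ne_zero _ (edge_sub_ne_zero hcθ t)
  have h3 := g.continuous
  fun_prop

include hc in
theorem norm_edgeQuotient_le (hcθ : c ≠ θ) (g : ℝ →ᵇ X) (t : ℝ) :
    ‖edgeQuotient θ n c g t‖ ≤ (|c - θ| ^ n)⁻¹ * Real.exp 1 * ‖g‖ * Real.exp (-1 * t ^ 2) := by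
  have h0 : 0 < |c - θ| := abs_pos.2 (sub_ne_zero.2 hcθ)
  rw [edgeQuotient, norm_smul, norm_mul, norm_inv, norm_pow]
  have h1 : |c - θ| ≤ ‖(c + t * Complex.I - θ : ℂ)‖ := by
    refine le_trans ?_ (Complex.abs_re_le_norm _)
    simp
  have h2 := norm_gaussAt_le (z := c + t * Complex.I) (θ := θ) (by simpa using hc)
  simp only [Complex.add_im, Complex.ofReal_im, Complex.mul_im, Complex.ofReal_re, Complex.I_im,
    mul_one, Complex.I_re, mul_zero, add_zero, zero_add] at h2
  have h3 : Real.exp (1 - t ^ 2) = Real.exp 1 * Real.exp (-1 * t ^ 2) := by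
    rw [← Real.exp_add]; ring_nf
  calc _ ≤ (|c - θ| ^ n)⁻¹ * Real.exp (1 - t ^ 2) * ‖g‖ := by
        gcongr
        exact g.norm_coe_le_norm t
    _ = _ := by rw [h3]; ring

include hc in
theorem integrable_edgeQuotient (hcθ : c ≠ θ) (g : ℝ →ᵇ X) :
    Integrable (edgeQuotient θ n c g) :=
  ((integrable_exp_neg_mul_sq zero_lt_one).const_mul _).mono'
    (continuous_edgeQuotient hcθ g).aestronglyMeasurable
    (Eventually.of_forall (norm_edgeQuotient_le hc hcθ g))

include hc in
theorem tendsto_edgeQuotient (hcθ : c ≠ θ) (g : ℝ →ᵇ X) :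
    Tendsto (edgeQuotient θ n c g) (cocompact ℝ) (𝓝 0) := by
  refine squeeze_zero_norm (norm_edgeQuotient_le hc hcθ g) ?_
  rw [← mul_zero ((|c - θ| ^ n)⁻¹ * Real.exp 1 * ‖g‖)]
  refine Tendsto.const_mul _ ?_
  refine Real.tendsto_exp_atBot.comp ?_
  have h : Tendsto (fun t : ℝ => ‖t‖ ^ 2) (cocompact ℝ) atTop :=
    (tendsto_pow_atTop two_ne_zero).comp (tendsto_norm_cocompact_atTop)
  refine (tendsto_neg_atTop_atBot.comp h).congr fun t => ?_
  simp

theorem continuous_fourier {X : Type*} [NormedAddCommGroup X] [NormedSpace ℂ X] {H : ℝ → X}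
    (hH : Integrable H) : Continuous (𝓕 H) :=
  VectorFourier.fourierIntegral_continuous Real.continuous_fourierChar continuous_inner hH

theorem norm_fourier_le {X : Type*} [NormedAddCommGroup X] [NormedSpace ℂ X] (H : ℝ → X) (v : ℝ) :
    ‖𝓕 H v‖ ≤ ∫ t, ‖H t‖ :=
  VectorFourier.norm_fourierIntegral_le_integral_norm _ _ _ _ _

/-- The density of the Gaussian mean of the Fourier integral of `H`, weighted on the line
`Re z = c`. -/
noncomputable def edgeDensity (n : ℕ) (H : ℝ → X) (b v : ℝ) : ℝ →ᵇ X :=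
  Complex.exp (-b * v ^ 2) • (edgeWeight θ n c hc v • BoundedContinuousFunction.const ℝ (𝓕 H v))

theorem continuous_edgeDensity {H : ℝ → X} (hH : Integrable H) (b : ℝ) :
    Continuous (edgeDensity hc n H b) := by
  have h1 := continuous_edgeWeight (n := n) hc
  have h2 := continuous_const_bcf.comp (continuous_fourier hH)
  have h3 : Continuous fun v => edgeWeight θ n c hc v • BoundedContinuousFunction.const ℝ (𝓕 H v) :=
    h1.smul h2
  have h4 : Continuous fun v : ℝ => Complex.exp (-b * v ^ 2) := by fun_prop
  exact h4.smul h3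

theorem norm_exp_neg_ofReal_mul_sq (b v : ℝ) : ‖Complex.exp (-b * v ^ 2)‖ = Real.exp (-b * v ^ 2) := by
  rw [Complex.norm_exp]
  norm_cast

theorem integrable_edgeDensity {H : ℝ → X} (hH : Integrable H) {b : ℝ} (hb : 0 < b) :
    Integrable (edgeDensity hc n H b) := by
  refine ((integrable_exp_neg_mul_sq hb).mul_const
    (n.factorial * Real.exp 3 * ∫ t, ‖H t‖)).mono'
    (continuous_edgeDensity hc hH b).aestronglyMeasurable (Eventually.of_forall fun v => ?_)
  rw [edgeDensity, norm_smul, norm_exp_neg_ofReal_mul_sq]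
  refine mul_le_mul_of_nonneg_left ((norm_smul_le _ _).trans ?_) (Real.exp_pos _).le
  have h1 : ‖BoundedContinuousFunction.const ℝ (𝓕 H v)‖ ≤ ∫ t, ‖H t‖ :=
    (BoundedContinuousFunction.norm_const_le _).trans (norm_fourier_le H v)
  gcongr
  exact norm_edgeWeight_le hc v

theorem integral_edgeDensity_apply [CompleteSpace X] {H : ℝ → X} (hH : Integrable H) {b : ℝ}
    (hb : 0 < b) (t : ℝ) : (∫ v, edgeDensity hc n H b v) t =
      ((c + t * Complex.I - θ) ^ n * gaussAt θ (c + t * Complex.I)) •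
        ∫ v : ℝ, Complex.exp (-b * v ^ 2 + 2 * Real.pi * t * v * Complex.I) • 𝓕 H v := by
  have h := (BoundedContinuousFunction.evalCLM ℂ t).integral_comp_comm
    (integrable_edgeDensity (n := n) hc hH hb)
  simp only [BoundedContinuousFunction.evalCLM_apply] at h
  rw [← h, ← integral_smul]
  refine integral_congr_ae (Eventually.of_forall fun v => ?_)
  change Complex.exp (-b * v ^ 2) • (edgeWeight θ n c hc v t • 𝓕 H v) = _
  rw [edgeWeight_apply]
  simp only [smul_smul]
  congr 1
  rw [Complex.exp_add]
  push_cast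
  ring_nf

/-- The outer factor (z - θ) ^ n `gaussAt θ z` is bounded on the edge, so the uniform approximation
of the quotient survives multiplication by it. It cancels the division and contributes the second
Gaussian. -/
theorem eventually_norm_integral_edgeDensity_sub_le [CompleteSpace X] (hcθ : c ≠ θ) (g : ℝ →ᵇ X)
    {ε : ℝ} (hε : 0 < ε) : ∀ᶠ b : ℝ in 𝓝[>] (0 : ℝ), ∀ t : ℝ,
      ‖(∫ v, edgeDensity hc n (edgeQuotient θ n c g) b v) t -
        gaussAt θ (c + t * Complex.I) ^ 2 • g t‖ ≤ ε := by
  have hH := integrable_edgeQuotient (n := n) hc hcθ g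
  have hK : 0 < (n.factorial : ℝ) * Real.exp 3 := by positivity
  filter_upwards [eventually_norm_gaussian_average_sub_le hH (continuous_edgeQuotient hcθ g)
    (tendsto_edgeQuotient hc hcθ g) (ε := ε / (n.factorial * Real.exp 3)) (by positivity),
    self_mem_nhdsWithin] with b hb hb0 t
  have h1 : gaussAt θ (c + t * Complex.I) ^ 2 • g t =
      ((c + t * Complex.I - θ) ^ n * gaussAt θ (c + t * Complex.I)) • edgeQuotient θ n c g t := by
    rw [edgeQuotient, smul_smul]
    congr 1
    have := pow_ne_zero n (edge_sub_ne_zero hcθ t)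
    field_simp
  rw [integral_edgeDensity_apply hc hH hb0, h1, ← smul_sub, norm_smul]
  have h2 : ‖(c + t * Complex.I - θ) ^ n * gaussAt θ (c + t * Complex.I)‖ ≤
      n.factorial * Real.exp 3 := by
    refine (norm_pow_mul_gaussAt_le (by simpa using hc) n).trans ?_
    simpa using one_add_abs_pow_mul_exp_le n t
  calc _ ≤ n.factorial * Real.exp 3 * (ε / (n.factorial * Real.exp 3)) := by
        gcongr
        exact hb t
    _ = ε := by field_simp

end Edge

/-- In the quotient by a closed subspace the integral becomes the integral of zero. This takes the
place of approximation by Riemann sums. -/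
theorem integral_mem_topologicalClosure {E : Type*} [NormedAddCommGroup E] [NormedSpace ℂ E]
    [CompleteSpace E] {S : Submodule ℂ E} {F : ℝ → E} (hF : Integrable F)
    (hS : ∀ v, F v ∈ S.topologicalClosure) : ∫ v, F v ∈ S.topologicalClosure := by
  have hcl : IsClosed (S.topologicalClosure : Set E) := S.isClosed_topologicalClosure
  have h := (S.topologicalClosure.mkQL).integral_comp_comm hF
  have h0 : ∀ v, S.topologicalClosure.mkQL (F v) = 0 := fun v =>
    (Submodule.Quotient.mk_eq_zero _).2 (hS v)
  simp only [h0, integral_zero] at h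
  exact (Submodule.Quotient.mk_eq_zero _).1 h.symm

theorem continuous_smul_const_bcf {Y X : Type*} [TopologicalSpace Y] [NormedAddCommGroup X]
    [NormedSpace ℂ X] (w : ℝ →ᵇ ℂ) {u : Y → X} (hu : Continuous u) :
    Continuous fun y => w • BoundedContinuousFunction.const ℝ (u y) :=
  Continuous.smul (continuous_const (y := w)) (continuous_const_bcf.comp hu)

/-! ### Approximation in 𝓕(A₀, A₁) by functions with values in D -/

namespace CompatibleCouple

variable (A : CompatibleCouple)

theorem incl₀_eq_incl₁_iff {x : A.X₀} {y : A.X₁} : A.incl₀ x = A.incl₁ y ↔ A.ι₀ x = A.ι₁ y := by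
  change Submodule.Quotient.mk _ = Submodule.Quotient.mk _ ↔ _
  rw [Submodule.Quotient.eq]
  change A.ι₀ (x - 0) + A.ι₁ (0 - y) = 0 ↔ _
  simp [← sub_eq_add_neg, sub_eq_zero]

theorem incl₀_injective : Function.Injective A.incl₀ := by
  intro x y h
  have h2 := (Submodule.Quotient.eq A.nullPairs).1 h
  have h3 : A.ι₀ (x - y) + A.ι₁ (0 - 0) = 0 := h2
  simp only [sub_self, map_zero, add_zero, map_sub, sub_eq_zero] at h3
  exact A.inj₀ h3

theorem incl₁_injective : Function.Injective A.incl₁ := by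
  intro x y h
  have h2 := (Submodule.Quotient.eq A.nullPairs).1 h
  have h3 : A.ι₀ (0 - 0) + A.ι₁ (x - y) = 0 := h2
  simp only [sub_self, map_zero, zero_add, map_sub, sub_eq_zero] at h3
  exact A.inj₁ h3

theorem norm_incl₀_le (x : A.X₀) : ‖A.incl₀ x‖ ≤ ‖x‖ := by
  refine (Submodule.Quotient.norm_mk_le A.nullPairs (WithLp.toLp 1 (x, (0 : A.X₁)))).trans ?_
  simp

theorem norm_incl₁_le (x : A.X₁) : ‖A.incl₁ x‖ ≤ ‖x‖ := by
  refine (Submodule.Quotient.norm_mk_le A.nullPairs (WithLp.toLp 1 ((0 : A.X₀), x))).trans ?_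
  simp

/-- The inclusion of `A₀` into `A₀ + A₁` as a continuous map. -/
noncomputable def inclL₀ : A.X₀ →L[ℂ] A.Sum :=
  A.incl₀.mkContinuous 1 fun x => by simpa using A.norm_incl₀_le x

/-- The inclusion of `A₁` into `A₀ + A₁` as a continuous map. -/
noncomputable def inclL₁ : A.X₁ →L[ℂ] A.Sum :=
  A.incl₁.mkContinuous 1 fun x => by simpa using A.norm_incl₁_le x

theorem inclL₀_apply (x : A.X₀) : A.inclL₀ x = A.incl₀ x := rfl

theorem inclL₁_apply (x : A.X₁) : A.inclL₁ x = A.incl₁ x := rfl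

variable {A}

/-- `f` vanishes weakly of order `n` at `θ`. -/
def VanishesAt (f : ℂ → A.Sum) (θ : ℝ) (n : ℕ) : Prop :=
  ∀ l : StrongDual ℂ A.Sum, ∃ h : ℂ → ℂ, ContinuousOn h {z | 0 ≤ z.re ∧ z.re ≤ 1} ∧
    DifferentiableOn ℂ h {z | 0 < z.re ∧ z.re < 1} ∧
    ∀ z : ℂ, 0 ≤ z.re → z.re ≤ 1 → l (f z) = (z - θ) ^ n * h z

section

variable {θ : ℝ} {n : ℕ} {f : ℂ → A.Sum} {g : (ℝ →ᵇ A.X₀) × (ℝ →ᵇ A.X₁)}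

/-- Tested against a functional, the Fourier integral over an edge is the line integral of
exp(-2πvz) `gaussAt θ z` h(z), whose integrand is the same holomorphic function for both edges. -/
theorem dual_fourier_edgeQuotient {X : Type*} [NormedAddCommGroup X] [NormedSpace ℂ X]
    [CompleteSpace X] (L : X →L[ℂ] A.Sum) {c : ℝ} (hcθ : c ≠ θ) (hc : |c - θ| ≤ 1) (g : ℝ →ᵇ X)
    (l : StrongDual ℂ A.Sum) (h : ℂ → ℂ)
    (hh : ∀ t : ℝ, l (L (g t)) = (c + t * Complex.I - θ) ^ n * h (c + t * Complex.I)) (v : ℝ) :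
    Integrable (fun t : ℝ => Complex.exp (-(2 * Real.pi * v) * (c + t * Complex.I)) *
      (gaussAt θ (c + t * Complex.I) * h (c + t * Complex.I))) ∧
    l (L (Complex.exp (-(2 * Real.pi * v) * c) • 𝓕 (edgeQuotient θ n c g) v)) =
      ∫ t : ℝ, Complex.exp (-(2 * Real.pi * v) * (c + t * Complex.I)) *
        (gaussAt θ (c + t * Complex.I) * h (c + t * Complex.I)) := by
  have hH := integrable_edgeQuotient (n := n) hc hcθ g
  have hI : Integrable fun t : ℝ =>
      Complex.exp (↑(-2 * Real.pi * t * v) * Complex.I) • edgeQuotient θ n c g t := by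
    refine (integrable_norm_iff ?_).1 ?_
    · have := continuous_edgeQuotient (n := n) hcθ g
      exact Continuous.aestronglyMeasurable (by fun_prop)
    · simpa only [norm_smul, Complex.norm_exp_ofReal_mul_I, one_mul] using hH.norm
  have hpt : ∀ t : ℝ, Complex.exp (-(2 * Real.pi * v) * (c + t * Complex.I)) *
      (gaussAt θ (c + t * Complex.I) * h (c + t * Complex.I)) =
      Complex.exp (-(2 * Real.pi * v) * c) • (l.comp L)
        (Complex.exp (↑(-2 * Real.pi * t * v) * Complex.I) • edgeQuotient θ n c g t) := by
    intro t
    have h1 := pow_ne_zero n (edge_sub_ne_zero hcθ t)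
    rw [edgeQuotient, map_smul, map_smul, ContinuousLinearMap.comp_apply, hh]
    simp only [smul_eq_mul]
    have h2 : Complex.exp (-(2 * Real.pi * v) * (c + t * Complex.I)) =
        Complex.exp (-(2 * Real.pi * v) * c) *
          Complex.exp (↑(-2 * Real.pi * t * v) * Complex.I) := by
      rw [← Complex.exp_add]
      congr 1
      push_cast
      ring
    have h3 : ∀ a e G X H : ℂ, X ≠ 0 → a * e * (G * H) = a * (e * (X⁻¹ * G * (X * H))) := by
      intro a e G X H hX
      field_simp
    rw [h2]
    exact h3 _ _ _ _ _ h1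
  constructor
  · simp_rw [hpt]
    exact ((l.comp L).integrable_comp hI).const_mul (Complex.exp (-(2 * Real.pi * v) * c))
  · simp_rw [hpt]
    rw [integral_smul, (l.comp L).integral_comp_comm hI, map_smul, map_smul,
      Real.fourier_real_eq_integral_exp_smul]
    rfl

/-- After testing with functionals, both sides are line integrals of one holomorphic function, and
Cauchy's theorem moves one edge to the other. The common value is thus a vector of A₀ ∩ A₁, although
the boundary functions take values in A₀ or A₁ only. -/
theorem incl₀_fourier_eq (h0 : 0 < θ) (h1 : θ < 1) (hf : (f, g) ∈ A.calderon)
    (hn : VanishesAt f θ n) (v : ℝ) :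
    A.incl₀ (𝓕 (edgeQuotient θ n 0 g.1) v) =
      A.incl₁ (Complex.exp (-(2 * Real.pi * v)) • 𝓕 (edgeQuotient θ n 1 g.2) v) := by
  refine (SeparatingDual.eq_iff_forall_dual_eq (R := ℂ)).2 fun l => ?_
  obtain ⟨h, hc, hd, hh⟩ := hn l
  have e0 := dual_fourier_edgeQuotient (θ := θ) (n := n) A.inclL₀ (c := 0) h0.ne
    (by rw [abs_le]; constructor <;> linarith) g.1 l h (fun t => by
      rw [inclL₀_apply, ← hf.2.1 t, ← hh _ (by simp) (by simp)]
      simp) v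
  have e1 := dual_fourier_edgeQuotient (θ := θ) (n := n) A.inclL₁ (c := 1) h1.ne'
    (by rw [abs_le]; constructor <;> linarith) g.2 l h (fun t => by
      rw [inclL₁_apply, ← hf.2.2 t, ← hh _ (by simp) (by simp)]
      simp) v
  simp only [Complex.ofReal_zero, mul_zero, Complex.exp_zero, one_smul, zero_add, inclL₀_apply]
    at e0
  simp only [Complex.ofReal_one, mul_one, inclL₁_apply] at e1
  rw [e0.2, e1.2]
  obtain ⟨-, -, R, hR⟩ := hf.1 l
  have hgc := continuous_gaussAt θ
  have hgd := differentiable_gaussAt θ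
  refine integral_strip_edges_eq (k := fun z => Complex.exp (-(2 * Real.pi * v) * z) *
    (gaussAt θ z * h z)) (C := Real.exp (2 * Real.pi * |v|) * (Real.exp 1 * R)) ?_ ?_ ?_ e0.1 e1.1
  · fun_prop
  · have : DifferentiableOn ℂ (fun z => Complex.exp (-(2 * Real.pi * v) * z))
        {z | 0 < z.re ∧ z.re < 1} := by fun_prop
    exact this.mul (hgd.differentiableOn.mul hd)
  · intro z hz0 hz1 him
    -- Away from the real axis division by (z - θ) ^ n does not increase the bound R; near θ only
    -- the continuity of the quotient is needed.
    have hzθ : 1 ≤ ‖z - θ‖ := by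
      refine him.trans ?_
      simpa using Complex.abs_im_le_norm (z - θ)
    have e2 : ‖h z‖ ≤ R := by
      have h2 := hR z hz0 hz1
      simp only at h2
      rw [hh z hz0 hz1, norm_mul, norm_pow] at h2
      exact (le_mul_of_one_le_left (norm_nonneg _) (one_le_pow₀ hzθ)).trans h2
    have e3 : ‖gaussAt θ z‖ ≤ Real.exp 1 * Real.exp (-|z.im|) := by
      refine (norm_gaussAt_le (by rw [abs_le]; constructor <;> linarith)).trans ?_
      rw [← Real.exp_add, Real.exp_le_exp, ← sq_abs]
      nlinarith
    have e4 : ‖Complex.exp (-(2 * Real.pi * v) * z)‖ ≤ Real.exp (2 * Real.pi * |v|) := by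
      rw [Complex.norm_exp, Real.exp_le_exp]
      have : (-(2 * Real.pi * v) * z : ℂ).re = 2 * Real.pi * (-v * z.re) := by
        simp; ring
      rw [this]
      refine mul_le_mul_of_nonneg_left ?_ Real.two_pi_pos.le
      calc -v * z.re ≤ |v| * z.re := mul_le_mul_of_nonneg_right (neg_le_abs v) hz0
        _ ≤ |v| := mul_le_of_le_one_right (abs_nonneg v) hz1
    have hR0 : 0 ≤ R := (norm_nonneg _).trans e2
    rw [norm_mul, norm_mul]
    calc _ ≤ Real.exp (2 * Real.pi * |v|) * (Real.exp 1 * Real.exp (-|z.im|) * R) := by gcongr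
      _ = _ := by ring

end

/-- The span of the functions `(z - θ) ^ n φ(z) d`, where `d ∈ D` and `φ` is entire such that
`(z - θ) ^ n φ(z)` is bounded on the strip. -/
def simpleMaps (D : Submodule ℂ A.Inter) (θ : ℝ) (n : ℕ) : Submodule ℂ (ℂ → D) :=
  Submodule.span ℂ {P | ∃ (φ : ℂ → ℂ) (d : D), Differentiable ℂ φ ∧
    (∃ R : ℝ, ∀ z : ℂ, 0 ≤ z.re → z.re ≤ 1 → ‖(z - θ) ^ n * φ z‖ ≤ R) ∧
    P = fun z => ((z - θ) ^ n * φ z) • d}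

theorem simpleMaps_le_zero (D : Submodule ℂ A.Inter) (θ : ℝ) (n : ℕ) :
    simpleMaps D θ n ≤ simpleMaps D θ 0 := by
  refine Submodule.span_mono ?_
  rintro P ⟨φ, d, hφ, ⟨R, hR⟩, rfl⟩
  exact ⟨fun z => (z - θ) ^ n * φ z, d, by fun_prop, ⟨R, by simpa using hR⟩, by simp⟩

/-- The boundary functions of the elements of `simpleMaps D θ n`. -/
def simpleEdges (D : Submodule ℂ A.Inter) (θ : ℝ) (n : ℕ) :
    Submodule ℂ ((ℝ →ᵇ A.X₀) × (ℝ →ᵇ A.X₁)) where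
  carrier := {y | ∃ P ∈ simpleMaps D θ n, (∀ t : ℝ, y.1 t = (P (t * Complex.I)).1.1.1) ∧
    ∀ t : ℝ, y.2 t = (P (1 + t * Complex.I)).1.1.2}
  zero_mem' := ⟨0, Submodule.zero_mem _, by simp, by simp⟩
  add_mem' := by
    rintro x y ⟨P, hP, h0, h1⟩ ⟨Q, hQ, h0', h1'⟩
    exact ⟨P + Q, add_mem hP hQ, by simp [h0, h0'], by simp [h1, h1']⟩
  smul_mem' := by
    rintro c x ⟨P, hP, h0, h1⟩
    exact ⟨c • P, Submodule.smul_mem _ c hP, by simp [h0], by simp [h1]⟩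

section

variable {D : Submodule ℂ A.Inter} {θ : ℝ} {n : ℕ}

/-- Both components come from the entire function `gaussAt θ z` exp(2πvz), which on Re z = 1 exceeds
the pure oscillation by the factor exp(2πv). -/
theorem edgeWeight_const_mem (h0 : |(0 : ℝ) - θ| ≤ 1) (h1 : |(1 : ℝ) - θ| ≤ 1) (v : ℝ) (d : D) :
    (edgeWeight θ n 0 h0 v • BoundedContinuousFunction.const ℝ d.1.1.1,
      edgeWeight θ n 1 h1 v • BoundedContinuousFunction.const ℝ
        (Complex.exp (2 * Real.pi * v) • d.1.1.2)) ∈ simpleEdges D θ n := by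
  refine ⟨fun z => ((z - θ) ^ n * (gaussAt θ z * Complex.exp (2 * Real.pi * v * z))) • d,
    Submodule.subset_span ⟨fun z => gaussAt θ z * Complex.exp (2 * Real.pi * v * z), d,
      (differentiable_gaussAt θ).mul (by fun_prop),
      ⟨n.factorial * Real.exp 3 * Real.exp (2 * Real.pi * |v|), ?_⟩, rfl⟩, ?_, ?_⟩
  · intro z hz0 hz1
    rw [abs_le] at h0 h1
    have e1 := norm_pow_mul_gaussAt_le (θ := θ) (z := z)
      (by rw [abs_le]; constructor <;> linarith) n
    have e2 := one_add_abs_pow_mul_exp_le n z.im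
    have e4 : ‖Complex.exp (2 * Real.pi * v * z)‖ ≤ Real.exp (2 * Real.pi * |v|) := by
      rw [Complex.norm_exp, Real.exp_le_exp]
      have : (2 * Real.pi * v * z : ℂ).re = 2 * Real.pi * (v * z.re) := by
        simp; ring
      rw [this]
      refine mul_le_mul_of_nonneg_left ?_ Real.two_pi_pos.le
      calc v * z.re ≤ |v| * z.re := mul_le_mul_of_nonneg_right (le_abs_self v) hz0
        _ ≤ |v| := mul_le_of_le_one_right (abs_nonneg v) hz1
    rw [← mul_assoc, norm_mul]
    have e5 := e1.trans e2
    gcongr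
  · intro t
    change edgeWeight θ n 0 h0 v t • d.1.1.1 = _ • d.1.1.1
    rw [edgeWeight_apply, ← mul_assoc]
    congr 2
    · simp
    · push_cast; ring_nf
  · intro t
    change edgeWeight θ n 1 h1 v t • (Complex.exp (2 * Real.pi * v) • d.1.1.2) = _ • d.1.1.2
    rw [edgeWeight_apply, smul_smul, ← mul_assoc, mul_assoc _ _ (Complex.exp (2 * Real.pi * v)),
      ← Complex.exp_add]
    push_cast
    ring_nf

theorem edgeWeight_const_mem_closure (hD : Dense (D : Set A.Inter)) (h0 : |(0 : ℝ) - θ| ≤ 1)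
    (h1 : |(1 : ℝ) - θ| ≤ 1) (v : ℝ) (x : A.Inter) :
    (edgeWeight θ n 0 h0 v • BoundedContinuousFunction.const ℝ x.1.1,
      edgeWeight θ n 1 h1 v • BoundedContinuousFunction.const ℝ
        (Complex.exp (2 * Real.pi * v) • x.1.2)) ∈ (simpleEdges D θ n).topologicalClosure := by
  let Φ : A.Inter → (ℝ →ᵇ A.X₀) × (ℝ →ᵇ A.X₁) := fun x =>
    (edgeWeight θ n 0 h0 v • BoundedContinuousFunction.const ℝ x.1.1,
      edgeWeight θ n 1 h1 v • BoundedContinuousFunction.const ℝ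
        (Complex.exp (2 * Real.pi * v) • x.1.2))
  have hx0 : Continuous fun x : A.Inter => x.1.1 := continuous_fst.comp continuous_subtype_val
  have hx1 : Continuous fun x : A.Inter => x.1.2 := continuous_snd.comp continuous_subtype_val
  have hy1 : Continuous fun x : A.Inter => Complex.exp (2 * Real.pi * v) • x.1.2 :=
    hx1.const_smul _
  have hcont : Continuous Φ := (continuous_smul_const_bcf _ hx0).prodMk
    (continuous_smul_const_bcf _ hy1)
  exact map_mem_closure (f := Φ) hcont (hD x) fun d hd => edgeWeight_const_mem h0 h1 v ⟨d, hd⟩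

/-- Up to a Gaussian factor, a function in `𝓕(A₀, A₁)` that vanishes of order `n` at `θ` is on the
boundary of the strip a uniform limit of simple functions of the same kind. -/
theorem exists_simpleMaps_approx (hD : Dense (D : Set A.Inter)) (h0 : 0 < θ) (h1 : θ < 1)
    {f : ℂ → A.Sum} {g : (ℝ →ᵇ A.X₀) × (ℝ →ᵇ A.X₁)} (hf : (f, g) ∈ A.calderon)
    (hn : VanishesAt f θ n) {ε : ℝ} (hε : 0 < ε) : ∃ P ∈ simpleMaps D θ n,
      (∀ t : ℝ, ‖(P (t * Complex.I)).1.1.1 - gaussAt θ (t * Complex.I) ^ 2 • g.1 t‖ ≤ ε) ∧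
      ∀ t : ℝ, ‖(P (1 + t * Complex.I)).1.1.2 - gaussAt θ (1 + t * Complex.I) ^ 2 • g.2 t‖ ≤
        ε := by
  have h0' : |(0 : ℝ) - θ| ≤ 1 := by rw [abs_le]; constructor <;> linarith
  have h1' : |(1 : ℝ) - θ| ≤ 1 := by rw [abs_le]; constructor <;> linarith
  obtain ⟨b, hb0, hb1, hb⟩ := ((eventually_norm_integral_edgeDensity_sub_le (n := n) h0' h0.ne g.1
    (half_pos hε)).and ((eventually_norm_integral_edgeDensity_sub_le (n := n) h1' h1.ne' g.2
    (half_pos hε)).and self_mem_nhdsWithin)).exists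
  have hI0 := integrable_edgeDensity (n := n) h0' (integrable_edgeQuotient (n := n) h0' h0.ne g.1) hb
  have hI1 := integrable_edgeDensity (n := n) h1'
    (integrable_edgeQuotient (n := n) h1' h1.ne' g.2) hb
  have hmem : ∫ v, (edgeDensity h0' n (edgeQuotient θ n 0 g.1) b v,
      edgeDensity h1' n (edgeQuotient θ n 1 g.2) b v) ∈
      (simpleEdges D θ n).topologicalClosure := by
    refine integral_mem_topologicalClosure (hI0.prodMk hI1) fun v => ?_
    have hx := incl₀_fourier_eq h0 h1 hf hn v
    have := edgeWeight_const_mem_closure (n := n) hD h0' h1' v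
      ⟨(𝓕 (edgeQuotient θ n 0 g.1) v,
        Complex.exp (-(2 * Real.pi * v)) • 𝓕 (edgeQuotient θ n 1 g.2) v),
        A.incl₀_eq_incl₁_iff.1 hx⟩
    -- The factor exp(2πv) of the right edge cancels the exp(-2πv) of the contour shift, leaving the
    -- two edge densities up to the Gaussian in v.
    simp only [smul_smul, ← Complex.exp_add, add_neg_cancel, Complex.exp_zero, one_smul] at this
    exact Submodule.smul_mem _ (Complex.exp (-b * v ^ 2)) this
  rw [integral_pair hI0 hI1] at hmem
  obtain ⟨y, ⟨P, hP, hP0, hP1⟩, hy⟩ := Metric.mem_closure_iff.1 hmem (ε / 2) (half_pos hε)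
  rw [dist_comm, dist_eq_norm, Prod.norm_def, max_lt_iff] at hy
  refine ⟨P, hP, fun t => ?_, fun t => ?_⟩
  · have e1 := hb0 t
    simp only [Complex.ofReal_zero, zero_add] at e1
    rw [← hP0]
    have e2 := ((y - (_, _)).1.norm_coe_le_norm t).trans hy.1.le
    refine (norm_sub_le_norm_sub_add_norm_sub _ _ _).trans (add_le_add e2 e1 |>.trans ?_)
    linarith
  · have e1 := hb1 t
    simp only [Complex.ofReal_one] at e1
    rw [← hP1]
    have e2 := ((y - (_, _)).2.norm_coe_le_norm t).trans hy.2.le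
    refine (norm_sub_le_norm_sub_add_norm_sub _ _ _).trans (add_le_add e2 e1 |>.trans ?_)
    linarith

end

end CompatibleCouple

end

section

open MeasureTheory

/-! ### Damping functions on the half-plane and the strip -/

/-- Since |arg w| ≤ π / 2, Re w ^ s = |w| ^ s cos(s arg w) is at least cos(π s / 2) |w| ^ s. The
damping relies on this cosine being positive, which fails at s = 1. -/
theorem cos_mul_abs_im_rpow_le_re_cpow {s : ℝ} (hs0 : 0 < s) (hs1 : s < 1) {w : ℂ}
    (hw : 0 ≤ w.re) : Real.cos (Real.pi / 2 * s) * |w.im| ^ s ≤ (w ^ (s : ℂ)).re := by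
  rcases eq_or_ne w 0 with rfl | h0
  · simp [hs0.ne', Complex.zero_cpow]
  have harg : |Complex.arg w| ≤ Real.pi / 2 := Complex.abs_arg_le_pi_div_two_iff.2 hw
  have hre : (w ^ (s : ℂ)).re = ‖w‖ ^ s * Real.cos (Complex.arg w * s) := by
    rw [Complex.cpow_def_of_ne_zero h0, Complex.exp_re, Complex.re_mul_ofReal,
      Complex.im_mul_ofReal, Complex.log_re, Complex.log_im,
      Real.rpow_def_of_pos (norm_pos_iff.2 h0)]
  have hpi := Real.pi_pos
  have hcos : Real.cos (Real.pi / 2 * s) ≤ Real.cos (Complex.arg w * s) := by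
    rw [← Real.cos_abs (Complex.arg w * s), abs_mul, abs_of_pos hs0]
    refine Real.cos_le_cos_of_nonneg_of_le_pi (by positivity) (by nlinarith) ?_
    gcongr
  have hcos0 : 0 ≤ Real.cos (Real.pi / 2 * s) :=
    Real.cos_nonneg_of_mem_Icc ⟨by nlinarith, by nlinarith⟩
  rw [hre, mul_comm]
  have h1 : |w.im| ^ s ≤ ‖w‖ ^ s := by
    gcongr
    exact Complex.abs_im_le_norm w
  gcongr

/-- This rational function vanishes at 1 with derivative 1 and stays bounded, so multiples of it can
correct a derivative at 1 without spoiling decay. -/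
theorem norm_four_mul_sub_div_le {w : ℂ} (hw : 0 ≤ w.re) : ‖4 * (w - 1) / (w + 1) ^ 2‖ ≤ 4 := by
  have h1 : 1 ≤ ‖w + 1‖ := by
    refine le_trans ?_ (Complex.re_le_norm _)
    simpa using hw
  have h2 : ‖w - 1‖ ≤ ‖w + 1‖ := by
    rw [← sq_le_sq₀ (norm_nonneg _) (norm_nonneg _), ← Complex.normSq_eq_norm_sq,
      ← Complex.normSq_eq_norm_sq]
    simp only [Complex.normSq_apply, Complex.sub_re, Complex.one_re, Complex.sub_im,
      Complex.one_im, sub_zero, Complex.add_re, Complex.add_im, add_zero]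
    nlinarith
  rw [norm_div, norm_mul, norm_pow, div_le_iff₀ (by positivity)]
  simp only [RCLike.norm_ofNat]
  nlinarith [norm_nonneg (w - 1)]

/-- A holomorphic function on the right half-plane with value `1` and derivative `0` at `1`, which
compensates growth of order `s < 1` along vertical lines. -/
noncomputable def halfPlaneDamping (C s L : ℝ) (w : ℂ) : ℂ :=
  (1 + (C / Real.cos (Real.pi / 2 * s) * s + L : ℝ) * (4 * (w - 1) / (w + 1) ^ 2)) *
    Complex.exp ((C / Real.cos (Real.pi / 2 * s) : ℝ) * (1 - w ^ (s : ℂ)) + (1 - w) * L)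

section Damping

variable {C s L : ℝ}

theorem add_one_ne_zero_of_re_nonneg {w : ℂ} (hw : 0 ≤ w.re) : w + 1 ≠ 0 := by
  intro h
  have := congrArg Complex.re h
  simp at this
  linarith

theorem continuousOn_halfPlaneDamping (hs0 : 0 < s) :
    ContinuousOn (halfPlaneDamping C s L) {w | 0 ≤ w.re} := by
  have h1 : ContinuousOn (fun w : ℂ => w ^ (s : ℂ)) {w | 0 ≤ w.re} := fun w hw =>
    (Complex.continuousAt_cpow_const_of_re_pos (Or.inl hw) (by simpa using hs0)).continuousWithinAt
  have h2 : ContinuousOn (fun w : ℂ => 4 * (w - 1) / (w + 1) ^ 2) {w | 0 ≤ w.re} :=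
    ContinuousOn.div (by fun_prop) (by fun_prop) fun w hw =>
      pow_ne_zero 2 (add_one_ne_zero_of_re_nonneg hw)
  unfold halfPlaneDamping
  fun_prop

theorem differentiableOn_halfPlaneDamping :
    DifferentiableOn ℂ (halfPlaneDamping C s L) {w | 0 < w.re} := by
  have h1 : DifferentiableOn ℂ (fun w : ℂ => w ^ (s : ℂ)) {w | 0 < w.re} := fun w hw =>
    (differentiableAt_id.cpow_const (Or.inl hw)).differentiableWithinAt
  have h2 : DifferentiableOn ℂ (fun w : ℂ => 4 * (w - 1) / (w + 1) ^ 2) {w | 0 < w.re} :=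
    DifferentiableOn.div (by fun_prop) (by fun_prop) fun w hw =>
      pow_ne_zero 2 (add_one_ne_zero_of_re_nonneg (le_of_lt hw))
  unfold halfPlaneDamping
  fun_prop

theorem halfPlaneDamping_one : halfPlaneDamping C s L 1 = 1 := by simp [halfPlaneDamping]

/-- The exponential factor has derivative -((C / cos(π s / 2)) s + L) at 1; the coefficient of the
rational factor is chosen to cancel it. -/
theorem hasDerivAt_halfPlaneDamping : HasDerivAt (halfPlaneDamping C s L) 0 1 := by
  have h1 : HasDerivAt (fun w : ℂ => w ^ (s : ℂ)) (s : ℂ) 1 := by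
    simpa using (hasDerivAt_id (1 : ℂ)).cpow_const (c := (s : ℂ)) (Or.inl (by simp))
  have h2 : HasDerivAt (fun w : ℂ => 4 * (w - 1) / (w + 1) ^ 2) 1 1 := by
    have := (((hasDerivAt_id (1 : ℂ)).sub_const 1).const_mul 4).div
      (((hasDerivAt_id (1 : ℂ)).add_const 1).pow 2) (by norm_num)
    convert! this using 1
    norm_num
  have h3 := ((h2.const_mul ((C / Real.cos (Real.pi / 2 * s) * s + L : ℝ) : ℂ)).const_add 1).mul
    (((h1.const_sub 1).const_mul ((C / Real.cos (Real.pi / 2 * s) : ℝ) : ℂ)).add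
      (((hasDerivAt_id (1 : ℂ)).const_sub 1).mul_const (L : ℂ))).cexp
  convert! h3 using 1
  simp
  ring

theorem norm_halfPlaneDamping_le (hC : 0 < C) (hs0 : 0 < s) (hs1 : s < 1) {w : ℂ}
    (hw : 0 ≤ w.re) : ‖halfPlaneDamping C s L w‖ ≤
      (1 + 4 * |C / Real.cos (Real.pi / 2 * s) * s + L|) *
        Real.exp (C / Real.cos (Real.pi / 2 * s) + L) *
        (Real.exp (-(L * w.re)) * Real.exp (-(C * |w.im| ^ s))) := by
  have hpi := Real.pi_pos
  have hcos : 0 < Real.cos (Real.pi / 2 * s) :=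
    Real.cos_pos_of_mem_Ioo ⟨by nlinarith, by nlinarith⟩
  have h1 := cos_mul_abs_im_rpow_le_re_cpow hs0 hs1 hw
  set a := Real.cos (Real.pi / 2 * s)
  rw [halfPlaneDamping, norm_mul]
  have e1 : ‖1 + (C / a * s + L : ℝ) * (4 * (w - 1) / (w + 1) ^ 2)‖ ≤
      1 + 4 * |C / a * s + L| := by
    refine (norm_add_le _ _).trans ?_
    rw [norm_one, norm_mul, Complex.norm_real, Real.norm_eq_abs, mul_comm (4 : ℝ)]
    gcongr
    exact norm_four_mul_sub_div_le hw
  have e2 : ‖Complex.exp ((C / a : ℝ) * (1 - w ^ (s : ℂ)) + (1 - w) * L)‖ ≤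
      Real.exp (C / a + L) * (Real.exp (-(L * w.re)) * Real.exp (-(C * |w.im| ^ s))) := by
    rw [Complex.norm_exp, ← Real.exp_add, ← Real.exp_add, Real.exp_le_exp, Complex.add_re,
      Complex.re_ofReal_mul, Complex.re_mul_ofReal, Complex.sub_re, Complex.sub_re,
      Complex.one_re]
    have h2 : C * |w.im| ^ s ≤ C / a * (w ^ (s : ℂ)).re := by
      calc C * |w.im| ^ s = C / a * (a * |w.im| ^ s) := by field_simp
        _ ≤ _ := by gcongr
    linarith
  rw [mul_assoc]
  gcongr

end Damping

/-- The norm bound in `exists_stripDamping`. -/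
noncomputable def dampingConst (M C s : ℝ) : ℝ :=
  (1 + 4 * (C / Real.cos (Real.pi / 2 * s) * s + |Real.log M| + 1)) *
    Real.exp (C / Real.cos (Real.pi / 2 * s) + Real.log M + 1)

theorem dampingConst_nonneg {M C s : ℝ} (hC : 0 < C) (hs0 : 0 < s) (hs1 : s < 1) :
    0 ≤ dampingConst M C s := by
  have hpi := Real.pi_pos
  have hcos : 0 < Real.cos (Real.pi / 2 * s) :=
    Real.cos_pos_of_mem_Ioo ⟨by nlinarith, by nlinarith⟩
  unfold dampingConst
  positivity

/-- The half-plane function is evaluated at z / θ with L = log M + θ log M₁, so that exp(-L Re z /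
θ) splits into the required powers of M and M₁. -/
theorem exists_stripDamping {M M₁ C s θ : ℝ} (hM : 0 < M) (hM₁ : 1 ≤ M₁) (hC : 0 < C)
    (hs0 : 0 < s) (hs1 : s < 1) (hθ : 0 < θ) (hθ' : θ * Real.log M₁ ≤ 1) :
    ∃ Φ : ℂ → ℂ, ContinuousOn Φ {z | 0 ≤ z.re} ∧ DifferentiableOn ℂ Φ {z | 0 < z.re} ∧
      Φ θ = 1 ∧ HasDerivAt Φ 0 θ ∧ ∀ z : ℂ, 0 ≤ z.re → ‖Φ z‖ ≤ dampingConst M C s *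
        (M ^ (-(z.re / θ)) * M₁ ^ (-z.re) * Real.exp (-(C * |z.im / θ| ^ s))) := by
  have hpi := Real.pi_pos
  have hcos : 0 < Real.cos (Real.pi / 2 * s) :=
    Real.cos_pos_of_mem_Ioo ⟨by nlinarith, by nlinarith⟩
  have hlog : 0 ≤ Real.log M₁ := Real.log_nonneg hM₁
  have hθc : (θ : ℂ) ≠ 0 := by exact_mod_cast hθ.ne'
  set L := Real.log M + θ * Real.log M₁ with hL
  refine ⟨fun z => halfPlaneDamping C s L (z / θ), ?_, ?_, ?_, ?_, ?_⟩
  · refine (continuousOn_halfPlaneDamping hs0).comp (by fun_prop) fun z hz => ?_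
    simp only [mem_ofPred_eq, Complex.div_ofReal_re] at hz ⊢
    positivity
  · refine differentiableOn_halfPlaneDamping.comp (by fun_prop) fun z hz => ?_
    simp only [mem_ofPred_eq, Complex.div_ofReal_re] at hz ⊢
    positivity
  · simp only [div_self hθc, halfPlaneDamping_one]
  · have h1 : HasDerivAt (fun z : ℂ => z / θ) (1 / θ) θ := (hasDerivAt_id _).div_const _
    have h2 : HasDerivAt (halfPlaneDamping C s L) 0 ((θ : ℂ) / θ) := by
      rw [div_self hθc]
      exact hasDerivAt_halfPlaneDamping
    simpa using! HasDerivAt.comp (h := fun z : ℂ => z / θ) (θ : ℂ) h2 h1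
  · intro z hz
    have h1 : 0 ≤ (z / θ).re := by
      rw [Complex.div_ofReal_re]
      positivity
    refine (norm_halfPlaneDamping_le hC hs0 hs1 h1).trans ?_
    rw [Complex.div_ofReal_re, Complex.div_ofReal_im]
    have h2 : Real.exp (-(L * (z.re / θ))) = M ^ (-(z.re / θ)) * M₁ ^ (-z.re) := by
      rw [Real.rpow_def_of_pos hM, Real.rpow_def_of_pos (by linarith), ← Real.exp_add, hL]
      congr 1
      field_simp
      ring
    rw [h2]
    -- The hypothesis θ log M₁ ≤ 1 replaces M₁ by an absolute constant, here and in the bound of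
    -- exp(L).
    have h3 : |C / Real.cos (Real.pi / 2 * s) * s + L| ≤
        C / Real.cos (Real.pi / 2 * s) * s + |Real.log M| + 1 := by
      rw [hL]
      have h4 : |θ * Real.log M₁| ≤ 1 := by rwa [abs_of_nonneg (by positivity)]
      have h5 : |C / Real.cos (Real.pi / 2 * s) * s| = C / Real.cos (Real.pi / 2 * s) * s :=
        abs_of_pos (by positivity)
      have h6 := abs_add_le (C / Real.cos (Real.pi / 2 * s) * s) (Real.log M + θ * Real.log M₁)
      have h7 := abs_add_le (Real.log M) (θ * Real.log M₁)
      linarith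
    rw [dampingConst]
    gcongr ?_ * ?_ * (_ * _)
    · gcongr
    · rw [Real.exp_le_exp]
      linarith

/-! ### Applying the family to D-valued functions -/

namespace CompatibleCouple

variable {A B : CompatibleCouple} {D : Submodule ℂ A.Inter} {T : ℂ → D →ₗ[ℂ] B.Sum} {θ : ℝ}

section

theorem isOpen_re_pos : IsOpen {z : ℂ | 0 < z.re} :=
  isOpen_lt continuous_const Complex.continuous_re

theorem differentiableAt_family (hT : IsAnalyticFamily T) (d : D) {ξ : ℂ} (hξ : 0 < ξ.re) :
    DifferentiableAt ℂ (fun ξ => T ξ d) ξ :=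
  differentiableAt_of_forall_dual isOpen_re_pos hξ (hT.differentiableOn d)

theorem simpleMaps_induction {n : ℕ} {p : (ℂ → D) → Prop}
    (hmem : ∀ (φ : ℂ → ℂ) (d : D), Differentiable ℂ φ →
      (∃ R : ℝ, ∀ z : ℂ, 0 ≤ z.re → z.re ≤ 1 → ‖(z - θ) ^ n * φ z‖ ≤ R) →
      p fun z => ((z - θ) ^ n * φ z) • d)
    (hadd : ∀ P Q, p P → p Q → p (P + Q)) {P : ℂ → D} (hP : P ∈ simpleMaps D θ n) : p P := by
  induction hP using Submodule.closure_induction with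
  | zero =>
    have := hmem 0 0 (differentiable_const 0) ⟨0, by simp⟩
    simp only [smul_zero] at this
    exact this
  | add P Q _ _ h1 h2 => exact hadd _ _ h1 h2
  | smul_mem c P h =>
    obtain ⟨φ, d, hφ, ⟨R, hR⟩, rfl⟩ := h
    have := hmem (fun z => c * φ z) d (by fun_prop) ⟨‖c‖ * R, fun z h0 h1 => by
      rw [mul_left_comm, norm_mul]
      exact mul_le_mul_of_nonneg_left (hR z h0 h1) (norm_nonneg _)⟩
    simpa [mul_smul, Pi.smul_def, mul_left_comm _ c] using this

theorem family_comp_weak (hT : IsAnalyticFamily T) (hθ : 0 < θ) {P : ℂ → D}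
    (hP : P ∈ simpleMaps D θ 0) (l : StrongDual ℂ B.Sum) :
    ContinuousOn (fun z => l (T (z / θ) (P z))) {z | 0 ≤ z.re ∧ z.re ≤ 1} ∧
      DifferentiableOn ℂ (fun z => l (T (z / θ) (P z))) {z | 0 < z.re ∧ z.re < 1} := by
  refine simpleMaps_induction (p := fun P =>
    ContinuousOn (fun z => l (T (z / θ) (P z))) {z | 0 ≤ z.re ∧ z.re ≤ 1} ∧
      DifferentiableOn ℂ (fun z => l (T (z / θ) (P z))) {z | 0 < z.re ∧ z.re < 1}) ?_ ?_ hP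
  · intro φ d hφ _
    have hφc := hφ.continuous
    simp only [map_smul, smul_eq_mul]
    constructor
    · refine ContinuousOn.mul (by fun_prop) ?_
      refine (hT.continuousOn d l).comp (by fun_prop) fun z hz => ?_
      have := hz.1
      simp only [mem_ofPred_eq, Complex.div_ofReal_re]
      positivity
    · refine DifferentiableOn.mul (by fun_prop) ?_
      refine (hT.differentiableOn d l).comp (by fun_prop) fun z hz => ?_
      have := hz.1
      simp only [mem_ofPred_eq, Complex.div_ofReal_re]
      positivity
  · intro P Q h1 h2
    simp only [Pi.add_apply, map_add]
    exact ⟨h1.1.add h2.1, h1.2.add h2.2⟩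

theorem family_comp_edge {X : Type*} [NormedAddCommGroup X] [NormedSpace ℂ X]
    (L : X →ₗ[ℂ] B.Sum) {γ : ℝ → ℂ} (hγ : Continuous γ)
    (hL : ∀ d : D, ∃ g : ℝ → X, Continuous g ∧ ∀ t, T (γ t / θ) d = L (g t)) {P : ℂ → D}
    (hP : P ∈ simpleMaps D θ 0) :
    ∃ g : ℝ → X, Continuous g ∧ ∀ t, T (γ t / θ) (P (γ t)) = L (g t) := by
  refine simpleMaps_induction (p := fun P =>
    ∃ g : ℝ → X, Continuous g ∧ ∀ t, T (γ t / θ) (P (γ t)) = L (g t)) ?_ ?_ hP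
  · intro φ d hφ _
    obtain ⟨g, hg, hg'⟩ := hL d
    have hφc := hφ.continuous
    exact ⟨fun t => ((γ t - θ) ^ 0 * φ (γ t)) • g t, by fun_prop, fun t => by
      simp only [map_smul, hg']⟩
  · rintro P Q ⟨g, hg, hg'⟩ ⟨h, hh, hh'⟩
    exact ⟨g + h, hg.add hh, fun t => by simp [hg', hh']⟩

theorem simpleMaps_bounded {P : ℂ → D} (hP : P ∈ simpleMaps D θ 0) :
    ∃ R : ℝ, 0 ≤ R ∧ ∀ z : ℂ, 0 ≤ z.re → z.re ≤ 1 → ‖(P z).1.1‖ ≤ R := by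
  refine simpleMaps_induction (p := fun P =>
    ∃ R : ℝ, 0 ≤ R ∧ ∀ z : ℂ, 0 ≤ z.re → z.re ≤ 1 → ‖(P z).1.1‖ ≤ R) ?_ ?_ hP
  · rintro φ d - ⟨R, hR⟩
    refine ⟨R * ‖d.1.1‖, mul_nonneg ((norm_nonneg _).trans (hR 0 (by simp) (by simp)))
      (norm_nonneg _), fun z h0 h1 => ?_⟩
    change ‖((z - θ) ^ 0 * φ z) • d.1.1‖ ≤ _
    rw [norm_smul]
    exact mul_le_mul_of_nonneg_right (hR z h0 h1) (norm_nonneg _)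
  · rintro P Q ⟨R, hR0, hR⟩ ⟨R', hR0', hR'⟩
    exact ⟨R + R', add_nonneg hR0 hR0', fun z h0 h1 =>
      (norm_add_le _ _).trans (add_le_add (hR z h0 h1) (hR' z h0 h1))⟩

theorem simpleMaps_apply_self {n : ℕ} (hn : n ≠ 0) {P : ℂ → D} (hP : P ∈ simpleMaps D θ n) :
    P θ = 0 := by
  refine simpleMaps_induction (p := fun P => P θ = 0) ?_ ?_ hP
  · intro φ d _ _
    simp [hn]
  · intro P Q h1 h2
    simp [h1, h2]

/-- Product and chain rule. The factor θ⁻¹ is the one compensated by the weight in the norm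
‖·‖_{δ'(0)}. -/
theorem hasDerivAt_family_comp_smul (hT : IsAnalyticFamily T) (hθ : 0 < θ) (d : D) {ψ : ℂ → ℂ}
    {ψ' : ℂ} (hψ : HasDerivAt ψ ψ' θ) : HasDerivAt (fun z => T (z / θ) (ψ z • d))
      (ψ θ • ((θ : ℂ)⁻¹ • deriv (fun ξ => T ξ d) 1) + ψ' • T 1 d) θ := by
  have hθc : (θ : ℂ) ≠ 0 := by exact_mod_cast hθ.ne'
  have h1 : HasDerivAt (fun z : ℂ => z / θ) (θ : ℂ)⁻¹ θ := by
    simpa using (hasDerivAt_id (θ : ℂ)).div_const (θ : ℂ)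
  have h2 : HasDerivAt (fun ξ => T ξ d) (deriv (fun ξ => T ξ d) 1) ((θ : ℂ) / θ) := by
    rw [div_self hθc]
    exact (differentiableAt_family hT d (by simp)).hasDerivAt
  have h3 := hψ.smul (HasDerivAt.scomp (h := fun z : ℂ => z / θ) (θ : ℂ) h2 h1)
  simpa [Function.comp_def, div_self hθc] using! h3

theorem hasDerivAt_family_comp (hT : IsAnalyticFamily T) (hθ : 0 < θ) {P : ℂ → D}
    (hP : P ∈ simpleMaps D θ 2) : HasDerivAt (fun z => T (z / θ) (P z)) 0 θ := by
  refine simpleMaps_induction (p := fun P => HasDerivAt (fun z => T (z / θ) (P z)) 0 θ) ?_ ?_ hP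
  · intro φ d hφ _
    have h1 : HasDerivAt (fun z : ℂ => (z - θ) ^ 2 * φ z) 0 θ := by
      simpa using! (((hasDerivAt_id (θ : ℂ)).sub_const (θ : ℂ)).pow 2).mul (hφ θ).hasDerivAt
    simpa using hasDerivAt_family_comp_smul hT hθ d h1
  · intro P Q h1 h2
    simpa using! h1.add h2

/-- On each edge the decay of Φ matches the growth of the family, which gives the norm estimates.
Inside the strip only some bound is needed, for membership in 𝓕(B₀, B₁); it may depend on P and M₁.
-/
theorem exists_calderon_family_comp {M₀ M₁ M C s : ℝ} (hM₀ : 0 < M₀) (hM : 0 < M) (hC : 0 < C)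
    (hs0 : 0 < s) (hs1 : s < 1) (hT : IsAnalyticFamily T) (hg : HasGrowth T M₀ M₁ M C s)
    (hθ : 0 < θ) (hθ' : θ * Real.log (max M₁ 1) ≤ 1) :
    ∃ Φ : ℂ → ℂ, Φ θ = 1 ∧ HasDerivAt Φ 0 θ ∧ ∀ P ∈ simpleMaps D θ 0, ∀ N₀ N₁ : ℝ,
      0 ≤ N₀ → 0 ≤ N₁ →
      (∀ t : ℝ, ‖(P (t * Complex.I)).1.1.1‖ ≤ N₀) →
      (∀ t : ℝ, ‖(P (1 + t * Complex.I)).1.1.2‖ ≤ N₁) →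
      ∃ b : (ℝ →ᵇ B.X₀) × (ℝ →ᵇ B.X₁), (fun z => Φ z • T (z / θ) (P z), b) ∈ B.calderon ∧
        ‖b.1‖ ≤ dampingConst M C s * M₀ * N₀ ∧ ‖b.2‖ ≤ dampingConst M C s * N₁ := by
  have hm1 : 1 ≤ max M₁ 1 := le_max_right _ _
  have hm0 : M₁ ≤ max M₁ 1 := le_max_left _ _
  set m := max M₁ 1
  have hm : 0 < m := by linarith
  have hK := dampingConst_nonneg (M := M) hC hs0 hs1
  obtain ⟨Φ, hΦc, hΦd, hΦ1, hΦ', hΦb⟩ := exists_stripDamping hM hm1 hC hs0 hs1 hθ hθ'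
  set K := dampingConst M C s
  refine ⟨Φ, hΦ1, hΦ', fun P hP N₀ N₁ hN₀ hN₁ hP0 hP1 => ?_⟩
  have hθc : (θ : ℂ) ≠ 0 := by exact_mod_cast hθ.ne'
  have hval0 : ∀ (t : ℝ) (d : D), ∃ b : B.X₀, T (t * Complex.I / θ) d = B.incl₀ b ∧
      ‖b‖ ≤ M₀ * Real.exp (C * |t / θ| ^ s) * ‖d.1.1.1‖ := by
    intro t d
    have := hg.bound₀ (t / θ) d
    push_cast at this
    rwa [div_mul_eq_mul_div] at this
  have hval1 : ∀ (z : ℂ) (d : D), 0 < z.re → ∃ b : B.X₁, T (z / θ) d = B.incl₁ b ∧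
      ‖b‖ ≤ m * M ^ (z.re / θ) * Real.exp (C * |z.im / θ| ^ s) * ‖d.1.1.2‖ := by
    intro z d hz
    obtain ⟨b, hb, hb'⟩ := hg.bound₁ (z.im / θ) (z.re / θ) (by positivity) d
    have e : ((z.re / θ : ℝ) : ℂ) + (z.im / θ : ℝ) * Complex.I = z / θ := by
      push_cast
      rw [div_mul_eq_mul_div, ← add_div, Complex.re_add_im]
    rw [e] at hb
    refine ⟨b, hb, hb'.trans ?_⟩
    gcongr
  have hΦ0 : ∀ (t : ℝ) (x : ℝ), 0 ≤ x →
      ‖Φ (t * Complex.I)‖ * (M₀ * Real.exp (C * |t / θ| ^ s) * x) ≤ K * M₀ * x := by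
    intro t x hx
    have h := hΦb (t * Complex.I) (by simp)
    simp only [Complex.mul_re, Complex.ofReal_re, Complex.I_re, mul_zero, Complex.ofReal_im,
      Complex.I_im, mul_one, sub_self, zero_div, neg_zero, Real.rpow_zero, Complex.mul_im,
      add_zero, one_mul] at h
    calc _ ≤ K * Real.exp (-(C * |t / θ| ^ s)) * (M₀ * Real.exp (C * |t / θ| ^ s) * x) := by
          gcongr
      _ = K * M₀ * x * (Real.exp (-(C * |t / θ| ^ s)) * Real.exp (C * |t / θ| ^ s)) := by ring
      _ = _ := by rw [← Real.exp_add]; simp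
  -- The factor m ^ (-Re z) m is 1 on the right edge, so M₁ drops out of the norm; in the interior
  -- it is at most m.
  have hΦ2 : ∀ (z : ℂ) (x : ℝ), 0 ≤ z.re → 0 ≤ x →
      ‖Φ z‖ * (m * M ^ (z.re / θ) * Real.exp (C * |z.im / θ| ^ s) * x) ≤
        K * (m ^ (-z.re) * m) * x := by
    intro z x hz hx
    calc _ ≤ K * (M ^ (-(z.re / θ)) * m ^ (-z.re) * Real.exp (-(C * |z.im / θ| ^ s))) *
          (m * M ^ (z.re / θ) * Real.exp (C * |z.im / θ| ^ s) * x) := by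
          gcongr
          exact hΦb z hz
      _ = K * (m ^ (-z.re) * m) * x * (M ^ (-(z.re / θ)) * M ^ (z.re / θ)) *
          (Real.exp (-(C * |z.im / θ| ^ s)) * Real.exp (C * |z.im / θ| ^ s)) := by ring
      _ = _ := by
          rw [← Real.exp_add, ← Real.rpow_add hM]
          simp
  obtain ⟨g0, hg0, hg0'⟩ := family_comp_edge (T := T) (θ := θ) B.incl₀
    (γ := fun t : ℝ => t * Complex.I) (by fun_prop) (fun d => by
      obtain ⟨g, hg, hg'⟩ := hT.continuous₀ d
      refine ⟨fun t => g (t / θ), by fun_prop, fun t => ?_⟩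
      rw [← hg']
      push_cast
      rw [div_mul_eq_mul_div]) hP
  obtain ⟨g1, hg1, hg1'⟩ := family_comp_edge (T := T) (θ := θ) B.incl₁
    (γ := fun t : ℝ => 1 + t * Complex.I) (by fun_prop) (fun d => by
      obtain ⟨g, hg, hg'⟩ := hT.continuous₁ d (1 / θ) (by positivity)
      refine ⟨fun t => g (t / θ), by fun_prop, fun t => ?_⟩
      rw [← hg']
      push_cast
      rw [div_mul_eq_mul_div, ← add_div]) hP
  have hb0 : ∀ t : ℝ, ‖Φ (t * Complex.I) • g0 t‖ ≤ K * M₀ * N₀ := by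
    intro t
    obtain ⟨b, hb, hb'⟩ := hval0 t (P (t * Complex.I))
    have : g0 t = b := B.incl₀_injective ((hg0' t).symm.trans hb)
    rw [this, norm_smul]
    refine le_trans ?_ (hΦ0 t N₀ hN₀)
    gcongr
    exact hb'.trans (by gcongr; exact hP0 t)
  have hb1 : ∀ t : ℝ, ‖Φ (1 + t * Complex.I) • g1 t‖ ≤ K * N₁ := by
    intro t
    obtain ⟨b, hb, hb'⟩ := hval1 (1 + t * Complex.I) (P (1 + t * Complex.I)) (by simp)
    have : g1 t = b := B.incl₁_injective ((hg1' t).symm.trans hb)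
    rw [this, norm_smul]
    have h3 := hΦ2 (1 + t * Complex.I) N₁ (by simp) hN₁
    have h4 : m ^ (-(1 + t * Complex.I : ℂ).re) * m = 1 := by
      simp [Real.rpow_neg_one, hm.ne']
    rw [h4, mul_one] at h3
    refine le_trans ?_ h3
    gcongr
    exact hb'.trans (by gcongr; exact hP1 t)
  have hc0 : Continuous fun t : ℝ => Φ (t * Complex.I) :=
    hΦc.comp_continuous (by fun_prop) fun t => by simp
  have hc1 : Continuous fun t : ℝ => Φ (1 + t * Complex.I) :=
    hΦc.comp_continuous (by fun_prop) fun t => by simp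
  have hcg0 : Continuous fun t : ℝ => Φ (t * Complex.I) • g0 t := hc0.smul hg0
  have hcg1 : Continuous fun t : ℝ => Φ (1 + t * Complex.I) • g1 t := hc1.smul hg1
  refine ⟨(BoundedContinuousFunction.ofNormedAddCommGroup _ hcg0 _ hb0,
    BoundedContinuousFunction.ofNormedAddCommGroup _ hcg1 _ hb1),
    ⟨fun l => ?_, fun t => ?_, fun t => ?_⟩,
    BoundedContinuousFunction.norm_ofNormedAddCommGroup_le _ (by positivity) hb0,
    BoundedContinuousFunction.norm_ofNormedAddCommGroup_le _ (by positivity) hb1⟩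
  · obtain ⟨h1, h2⟩ := family_comp_weak hT hθ hP l
    obtain ⟨R, hR0, hR⟩ := simpleMaps_bounded hP
    simp only [map_smul, smul_eq_mul]
    refine ⟨(hΦc.mono fun z hz => hz.1).mul h1, (hΦd.mono fun z hz => hz.1).mul h2,
      ‖l‖ * (K * M₀ * R + K * m * R), fun z hz0 hz1 => ?_⟩
    have hlT := l.le_opNorm (T (z / θ) (P z))
    rw [norm_mul]
    have key : ‖Φ z‖ * ‖T (z / θ) (P z)‖ ≤ K * M₀ * R + K * m * R := by
      have hRz := hR z hz0 hz1
      -- The growth bound into B₁ is assumed only for α > 0, so the left edge uses the bound into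
      -- B₀.
      rcases hz0.eq_or_lt with h | h
      · have hz : z = z.im * Complex.I := by
          apply Complex.ext <;> simp [← h]
        rw [hz] at hRz ⊢
        obtain ⟨b, hb, hb'⟩ := hval0 z.im (P (z.im * Complex.I))
        rw [hb]
        have h3 : ‖B.incl₀ b‖ ≤ M₀ * Real.exp (C * |z.im / θ| ^ s) * R :=
          (B.norm_incl₀_le b).trans (hb'.trans (by
            gcongr
            exact (norm_fst_le _).trans hRz))
        have h4 := hΦ0 z.im R hR0
        have h5 : 0 ≤ K * m * R := by positivity
        have h6 := mul_le_mul_of_nonneg_left h3 (norm_nonneg (Φ (z.im * Complex.I)))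
        linarith
      · obtain ⟨b, hb, hb'⟩ := hval1 z (P z) h
        rw [hb]
        have h3 : ‖B.incl₁ b‖ ≤ m * M ^ (z.re / θ) * Real.exp (C * |z.im / θ| ^ s) * R :=
          (B.norm_incl₁_le b).trans (hb'.trans (by
            gcongr
            exact (norm_snd_le _).trans hRz))
        have h4 := hΦ2 z R hz0 hR0
        have h5 : 0 ≤ K * M₀ * R := by positivity
        have h6 := mul_le_mul_of_nonneg_left h3 (norm_nonneg (Φ z))
        have h7 : K * (m ^ (-z.re) * m) * R ≤ K * m * R := by
          gcongr
          refine mul_le_of_le_one_left hm.le ?_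
          exact Real.rpow_le_one_of_one_le_of_nonpos hm1 (by linarith)
        linarith
    calc _ ≤ ‖Φ z‖ * (‖l‖ * ‖T (z / θ) (P z)‖) := by gcongr
      _ = ‖l‖ * (‖Φ z‖ * ‖T (z / θ) (P z)‖) := by ring
      _ ≤ _ := by gcongr
  · change Φ _ • T _ _ = B.incl₀ (Φ _ • g0 t)
    rw [map_smul, ← hg0']
  · change Φ _ • T _ _ = B.incl₁ (Φ _ • g1 t)
    rw [map_smul, ← hg1']

end

end CompatibleCouple

end

/-! ### Comparing infima, and extension to completions -/

namespace ExtSeminorm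

/-- The slack ε pays for the approximation by D-valued functions, which reproduces boundary norms
only up to an error. -/
theorem ofRel_le_mul {E F G G' : Type*} [AddCommGroup E] [Module ℂ E] [AddCommGroup F] [Module ℂ F]
    [NormedAddCommGroup G] [NormedSpace ℂ G] [NormedAddCommGroup G'] [NormedSpace ℂ G']
    {R : Submodule ℂ (G × E)} {R' : Submodule ℂ (G' × F)} {x : E} {y : F} {K : ℝ} (hK : 0 < K)
    (h : ∀ g, (g, x) ∈ R → ∀ ε : ℝ, 0 < ε → ∃ g', (g', y) ∈ R' ∧ ‖g'‖ ≤ K * ‖g‖ + ε) :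
    ofRel R' y ≤ ENNReal.ofReal K * ofRel R x := by
  change _ ≤ ENNReal.ofReal K * ⨅ (g : G) (_ : (g, x) ∈ R), ‖g‖ₑ
  have hK0 : ENNReal.ofReal K ≠ 0 := by simpa using hK
  rw [ENNReal.mul_iInf_of_ne hK0 ENNReal.ofReal_ne_top]
  refine le_iInf fun g => ?_
  rw [ENNReal.mul_iInf_of_ne hK0 ENNReal.ofReal_ne_top]
  refine le_iInf fun hg => ?_
  refine ENNReal.le_of_forall_pos_le_add fun ε hε _ => ?_
  obtain ⟨g', hg', hle⟩ := h g hg ε (by exact_mod_cast hε)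
  refine (iInf₂_le g' hg').trans ?_
  rw [← ofReal_norm, ← ofReal_norm, ← ENNReal.ofReal_mul hK.le, ← ENNReal.ofReal_coe_nnreal,
    ← ENNReal.ofReal_add (by positivity) (by positivity)]
  exact ENNReal.ofReal_le_ofReal hle

theorem comap_apply {E F : Type*} [AddCommGroup E] [Module ℂ E] [AddCommGroup F] [Module ℂ F]
    (p : ExtSeminorm F) (f : E →ₗ[ℂ] F) (x : E) : p.comap f x = p (f x) := rfl

theorem isBoundedExt_of_le {E F : Type*} [AddCommGroup E] [Module ℂ E] [AddCommGroup F]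
    [Module ℂ F] {p : ExtSeminorm E} {q : ExtSeminorm F} {L : E → F} {K : ℝ} (hK : 0 ≤ K)
    (hadd : ∀ x y, L (x + y) = L x + L y) (hsmul : ∀ (c : ℂ) x, L (c • x) = c • L x)
    (hp : ∀ x, p x < ∞) (h : ∀ x, q (L x) ≤ ENNReal.ofReal K * p x) : IsBoundedExt p q L K := by
  have hq : ∀ x, q (L x) < ∞ := fun x =>
    (h x).trans_lt (ENNReal.mul_lt_top ENNReal.ofReal_lt_top (hp x))
  let S₀ : p.Space →ₗ[ℂ] q.Space :=
    { toFun := fun x => q.point (L (Subtype.val x)) (hq _)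
      map_add' := fun x y => Subtype.ext (hadd (Subtype.val x) (Subtype.val y))
      map_smul' := fun c x => Subtype.ext (hsmul c (Subtype.val x)) }
  have hS₀ : ∀ x, ‖S₀ x‖ ≤ K * ‖x‖ := fun x => by
    change (q (L (Subtype.val x))).toReal ≤ K * (p (Subtype.val x)).toReal
    rw [← ENNReal.toReal_ofReal hK, ← ENNReal.toReal_mul]
    exact ENNReal.toReal_mono (ENNReal.mul_lt_top ENNReal.ofReal_lt_top (hp _)).ne (h _)
  let e : p.Space →ₗ[ℂ] p.Compl :=
    (UniformSpace.Completion.toComplL (𝕜 := ℂ) (E := p.Space)).toLinearMap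
  let S₁ : p.Space →ₗ[ℂ] q.Compl :=
    (UniformSpace.Completion.toComplL (𝕜 := ℂ) (E := q.Space)).toLinearMap ∘ₗ S₀
  have hdense : DenseRange e := UniformSpace.Completion.denseRange_coe
  have hS₁ : ∀ x, ‖S₁ x‖ ≤ K * ‖e x‖ := fun x => by
    change ‖((S₀ x : q.Space) : q.Compl)‖ ≤ K * ‖(x : p.Compl)‖
    rw [UniformSpace.Completion.norm_coe, UniformSpace.Completion.norm_coe]
    exact hS₀ x
  exact ⟨S₁.extendOfNorm e, LinearMap.opNorm_extendOfNorm_le hdense hK hS₁, fun x =>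
    ⟨hp x, hq x, LinearMap.extendOfNorm_eq hdense ⟨K, hS₁⟩ (p.point x (hp x))⟩⟩

end ExtSeminorm

/-! ### Estimates at a fixed θ -/

namespace CompatibleCouple

section

variable {A B : CompatibleCouple} {D : Submodule ℂ A.Inter} {T : ℂ → D →ₗ[ℂ] B.Sum} {θ : ℝ}

theorem openStrip_mem_nhds (h0 : 0 < θ) (h1 : θ < 1) : {z : ℂ | 0 < z.re ∧ z.re < 1} ∈ 𝓝 (θ : ℂ) :=
  ((isOpen_lt continuous_const Complex.continuous_re).inter
    (isOpen_lt Complex.continuous_re continuous_const)).mem_nhds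
    (show 0 < (θ : ℂ).re ∧ (θ : ℂ).re < 1 from ⟨by simpa, by simpa⟩)

theorem dslope_strip (h0 : 0 < θ) (h1 : θ < 1) {φ : ℂ → ℂ}
    (hc : ContinuousOn φ {z | 0 ≤ z.re ∧ z.re ≤ 1})
    (hd : DifferentiableOn ℂ φ {z | 0 < z.re ∧ z.re < 1}) :
    ContinuousOn (dslope φ θ) {z | 0 ≤ z.re ∧ z.re ≤ 1} ∧
      DifferentiableOn ℂ (dslope φ θ) {z | 0 < z.re ∧ z.re < 1} := by
  have hn := openStrip_mem_nhds h0 h1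
  have hn' : {z : ℂ | 0 ≤ z.re ∧ z.re ≤ 1} ∈ 𝓝 (θ : ℂ) :=
    mem_of_superset hn fun z hz => ⟨hz.1.le, hz.2.le⟩
  exact ⟨(continuousOn_dslope hn').2
    ⟨hc, hd.differentiableAt hn⟩, (Complex.differentiableOn_dslope hn).2 hd⟩

theorem vanishesAt_one (h0 : 0 < θ) (h1 : θ < 1) {f : ℂ → A.Sum}
    {g : (ℝ →ᵇ A.X₀) × (ℝ →ᵇ A.X₁)} (hf : (f, g) ∈ A.calderon) (hfθ : f θ = 0) :
    VanishesAt f θ 1 := by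
  intro l
  obtain ⟨hc, hd, -⟩ := hf.1 l
  obtain ⟨hc', hd'⟩ := dslope_strip h0 h1 hc hd
  refine ⟨_, hc', hd', fun z _ _ => ?_⟩
  have := sub_smul_dslope (fun z => l (f z)) (θ : ℂ) z
  simp only [hfθ, map_zero, sub_zero, smul_eq_mul] at this
  rw [pow_one, this]

/-- Two successive difference quotients at θ; the vanishing derivative is what makes the first one
vanish there. -/
theorem vanishesAt_two (h0 : 0 < θ) (h1 : θ < 1) {f : ℂ → A.Sum}
    {g : (ℝ →ᵇ A.X₀) × (ℝ →ᵇ A.X₁)} (hf : (f, g) ∈ A.calderon) (hfθ : f θ = 0)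
    (hfθ' : HasDerivAt f 0 θ) : VanishesAt f θ 2 := by
  intro l
  obtain ⟨hc, hd, -⟩ := hf.1 l
  obtain ⟨hc', hd'⟩ := dslope_strip h0 h1 hc hd
  obtain ⟨hc'', hd''⟩ := dslope_strip h0 h1 hc' hd'
  refine ⟨_, hc'', hd'', fun z _ _ => ?_⟩
  have e1 := sub_smul_dslope (fun z => l (f z)) (θ : ℂ) z
  have e2 := sub_smul_dslope (dslope (fun z => l (f z)) θ) (θ : ℂ) z
  have e3 : dslope (fun z => l (f z)) θ θ = 0 := by
    rw [dslope_same]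
    have : HasDerivAt (fun z => l (f z)) (l 0) θ :=
      l.hasFDerivAt.comp_hasDerivAt (θ : ℂ) hfθ'
    rw [this.deriv, map_zero]
  rw [e3, sub_zero, smul_eq_mul] at e2
  simp only [hfθ, map_zero, sub_zero, smul_eq_mul] at e1
  rw [sq, mul_assoc, e2, e1]

theorem mem_boundaryRel_iff {P : Submodule ℂ ((ℂ → A.Sum) × A.Sum)}
    {g : (ℝ →ᵇ A.X₀) × (ℝ →ᵇ A.X₁)} {a : A.Sum} :
    (g, a) ∈ A.boundaryRel P ↔ ∃ f : ℂ → A.Sum, (f, g) ∈ A.calderon ∧ (f, a) ∈ P := Iff.rfl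

/-- The constant functions with values in `A₀ ∩ A₁`, with their boundary functions. -/
theorem const_mem_calderon (x : A.Inter) :
    ((fun _ => A.inclInter x, (BoundedContinuousFunction.const ℝ x.1.1,
      BoundedContinuousFunction.const ℝ x.1.2)) :
      (ℂ → A.Sum) × (ℝ →ᵇ A.X₀) × (ℝ →ᵇ A.X₁)) ∈ A.calderon := by
  have h : ∀ l : StrongDual ℂ A.Sum, MemStripAlgebra fun _ => l (A.inclInter x) := fun l =>
    ⟨continuousOn_const, differentiableOn_const _, _, fun _ _ _ => le_rfl⟩
  exact ⟨h, fun t => rfl, fun t => A.incl₀_eq_incl₁_iff.2 x.2⟩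

theorem norm_gaussAt_sq_le (h0 : 0 < θ) (h1 : θ < 1) {z : ℂ} (hz0 : 0 ≤ z.re) (hz1 : z.re ≤ 1) :
    ‖gaussAt θ z ^ 2‖ ≤ Real.exp 2 := by
  have h := norm_gaussAt_le (θ := θ) (z := z) (by rw [abs_le]; constructor <;> linarith)
  have h2 : Real.exp (1 - z.im ^ 2) ≤ Real.exp 1 := Real.exp_le_exp.2 (by nlinarith [sq_nonneg z.im])
  rw [norm_pow]
  calc _ ≤ Real.exp 1 ^ 2 := by gcongr; exact h.trans h2
    _ = _ := by rw [← Real.exp_nat_mul]; norm_num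

/-- Approximating f - d instead of f keeps the conditions at θ exact: P vanishes there to order n,
while `gaussAt θ z` ^ 2 • d carries the value d. On the edges the sum is within ε of the Gaussian
multiple of f, and the squared Gaussian is at most e² on the strip. -/
theorem exists_simpleMaps_of_vanishesAt (hD : Dense (D : Set A.Inter)) (h0 : 0 < θ) (h1 : θ < 1)
    (d : D) {n : ℕ} {f : ℂ → A.Sum} {g : (ℝ →ᵇ A.X₀) × (ℝ →ᵇ A.X₁)} (hf : (f, g) ∈ A.calderon)
    (hn : VanishesAt (fun z => f z - inclOf D d) θ n) {ε : ℝ} (hε : 0 < ε) :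
    ∃ P ∈ simpleMaps D θ n,
      (fun z => gaussAt θ z ^ 2 • d) + P ∈ simpleMaps D θ 0 ∧
      (∀ t : ℝ, ‖(gaussAt θ (t * Complex.I) ^ 2 • d + P (t * Complex.I)).1.1.1‖ ≤
        Real.exp 2 * ‖g‖ + ε) ∧
      ∀ t : ℝ, ‖(gaussAt θ (1 + t * Complex.I) ^ 2 • d + P (1 + t * Complex.I)).1.1.2‖ ≤
        Real.exp 2 * ‖g‖ + ε := by
  have hf' := A.calderon.sub_mem hf (const_mem_calderon d.1)
  obtain ⟨P, hP, hP0, hP1⟩ := exists_simpleMaps_approx hD h0 h1 hf' hn hε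
  refine ⟨P, hP, add_mem ?_ (simpleMaps_le_zero D θ n hP), fun t => ?_, fun t => ?_⟩
  · refine Submodule.subset_span ⟨fun z => gaussAt θ z ^ 2, d, (differentiable_gaussAt θ).pow 2,
      ⟨Real.exp 2, fun z hz0 hz1 => ?_⟩, by simp⟩
    rw [pow_zero, one_mul]
    exact norm_gaussAt_sq_le h0 h1 hz0 hz1
  · have e1 := hP0 t
    have e2 : ‖gaussAt θ (t * Complex.I) ^ 2 • g.1 t‖ ≤ Real.exp 2 * ‖g‖ := by
      rw [norm_smul]
      gcongr
      · exact norm_gaussAt_sq_le h0 h1 (by simp) (by simp)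
      · exact (g.1.norm_coe_le_norm t).trans (norm_fst_le g)
    have e3 : (gaussAt θ (t * Complex.I) ^ 2 • d + P (t * Complex.I)).1.1.1 =
        ((P (t * Complex.I)).1.1.1 - gaussAt θ (t * Complex.I) ^ 2 • (g.1 t - d.1.1.1)) +
          gaussAt θ (t * Complex.I) ^ 2 • g.1 t := by
      change gaussAt θ (t * Complex.I) ^ 2 • d.1.1.1 + (P (t * Complex.I)).1.1.1 = _
      rw [smul_sub]
      abel
    rw [e3, add_comm (Real.exp 2 * ‖g‖)]
    exact (norm_add_le _ _).trans (add_le_add e1 e2)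
  · have e1 := hP1 t
    have e2 : ‖gaussAt θ (1 + t * Complex.I) ^ 2 • g.2 t‖ ≤ Real.exp 2 * ‖g‖ := by
      rw [norm_smul]
      gcongr
      · exact norm_gaussAt_sq_le h0 h1 (by simp) (by simp)
      · exact (g.2.norm_coe_le_norm t).trans (norm_snd_le g)
    have e3 : (gaussAt θ (1 + t * Complex.I) ^ 2 • d + P (1 + t * Complex.I)).1.1.2 =
        ((P (1 + t * Complex.I)).1.1.2 - gaussAt θ (1 + t * Complex.I) ^ 2 • (g.2 t - d.1.1.2)) +
          gaussAt θ (1 + t * Complex.I) ^ 2 • g.2 t := by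
      change gaussAt θ (1 + t * Complex.I) ^ 2 • d.1.1.2 + (P (1 + t * Complex.I)).1.1.2 = _
      rw [smul_sub]
      abel
    rw [e3, add_comm (Real.exp 2 * ‖g‖)]
    exact (norm_add_le _ _).trans (add_le_add e1 e2)

end

end CompatibleCouple

/-- The bound for the operators in the interpolation theorem. -/
noncomputable def familyConst (M₀ M C s : ℝ) : ℝ :=
  dampingConst M C s * max M₀ 1 * Real.exp 2

namespace CompatibleCouple

section

variable {A B : CompatibleCouple} {D : Submodule ℂ A.Inter} {T : ℂ → D →ₗ[ℂ] B.Sum} {θ : ℝ}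
  {M₀ M₁ M C s : ℝ}

theorem familyConst_pos (hC : 0 < C) (hs0 : 0 < s) (hs1 : s < 1) : 0 < familyConst M₀ M C s := by
  have hpi := Real.pi_pos
  have hcos : 0 < Real.cos (Real.pi / 2 * s) :=
    Real.cos_pos_of_mem_Ioo ⟨by nlinarith, by nlinarith⟩
  unfold familyConst dampingConst
  have : 0 < max M₀ 1 := lt_max_of_lt_right one_pos
  positivity

/-- From `f ∈ 𝓕(A₀, A₁)` with `f - d` vanishing of order `n` at `θ` to an element of
`𝓕(B₀, B₁)` that near `θ` has the form `Φ(z) T_{z / θ} (q(z)² d + P(z))`. -/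
theorem exists_calderon_family (hD : Dense (D : Set A.Inter)) (hM₀ : 0 < M₀) (hM : 0 < M)
    (hC : 0 < C) (hs0 : 0 < s) (hs1 : s < 1) (hT : IsAnalyticFamily T)
    (hg : HasGrowth T M₀ M₁ M C s) (h0 : 0 < θ) (h1 : θ < 1)
    (hθ' : θ * Real.log (max M₁ 1) ≤ 1) (d : D) {n : ℕ} {f : ℂ → A.Sum}
    {g : (ℝ →ᵇ A.X₀) × (ℝ →ᵇ A.X₁)} (hf : (f, g) ∈ A.calderon)
    (hn : VanishesAt (fun z => f z - inclOf D d) θ n) {ε : ℝ} (hε : 0 < ε) :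
    ∃ P ∈ simpleMaps D θ n, ∃ Φ : ℂ → ℂ, Φ θ = 1 ∧ HasDerivAt Φ 0 θ ∧
      ∃ b : (ℝ →ᵇ B.X₀) × (ℝ →ᵇ B.X₁),
        (fun z => Φ z • T (z / θ) (gaussAt θ z ^ 2 • d + P z), b) ∈ B.calderon ∧
        ‖b‖ ≤ familyConst M₀ M C s * ‖g‖ + ε := by
  have hK := dampingConst_nonneg (M := M) hC hs0 hs1
  have hm1 : 1 ≤ max M₀ 1 := le_max_right _ _
  have hm0 : M₀ ≤ max M₀ 1 := le_max_left _ _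
  obtain ⟨Φ, hΦ1, hΦ', hΦ⟩ := exists_calderon_family_comp hM₀ hM hC hs0 hs1 hT hg h0 hθ'
  set K := dampingConst M C s with hKdef
  set m := max M₀ 1 with hmdef
  -- The error is later multiplied by at most K * m; adding 1 to the denominator avoids division by
  -- zero.
  obtain ⟨P, hP, hPs, hP0, hP1⟩ := exists_simpleMaps_of_vanishesAt hD h0 h1 d hf hn
    (ε := ε / (K * m + 1)) (by positivity)
  have hN : 0 ≤ Real.exp 2 * ‖g‖ + ε / (K * m + 1) := by positivity
  obtain ⟨b, hb, hb0, hb1⟩ := hΦ _ hPs _ _ hN hN hP0 hP1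
  refine ⟨P, hP, Φ, hΦ1, hΦ', b, hb, ?_⟩
  have hfin : K * m * (Real.exp 2 * ‖g‖ + ε / (K * m + 1)) ≤ familyConst M₀ M C s * ‖g‖ + ε := by
    have h2 : K * m * (ε / (K * m + 1)) ≤ ε := by
      rw [mul_div_assoc', div_le_iff₀ (by positivity)]
      nlinarith
    rw [familyConst, ← hKdef, ← hmdef]
    nlinarith
  rw [Prod.norm_def]
  refine max_le (hb0.trans (le_trans ?_ hfin)) (hb1.trans (le_trans ?_ hfin))
  · gcongr
  · exact mul_le_mul_of_nonneg_right (le_mul_of_one_le_right hK hm1) hN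

/-- Order of vanishing one suffices: at z = θ the term P drops out, all scalar factors are 1, and T₁
d remains. -/
theorem normTheta_family_le (hD : Dense (D : Set A.Inter)) (hM₀ : 0 < M₀) (hM : 0 < M)
    (hC : 0 < C) (hs0 : 0 < s) (hs1 : s < 1) (hT : IsAnalyticFamily T)
    (hg : HasGrowth T M₀ M₁ M C s) (h0 : 0 < θ) (h1 : θ < 1)
    (hθ' : θ * Real.log (max M₁ 1) ≤ 1) (d : D) :
    B.normTheta θ (T 1 d) ≤
      ENNReal.ofReal (familyConst M₀ M C s) * A.normTheta θ (inclOf D d) := by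
  have hθc : (θ : ℂ) ≠ 0 := by exact_mod_cast h0.ne'
  refine ExtSeminorm.ofRel_le_mul (familyConst_pos hC hs0 hs1) fun g hgr ε hε => ?_
  obtain ⟨f, hf, hfd⟩ := mem_boundaryRel_iff.1 hgr
  have hfd : f θ = inclOf D d := hfd
  have hv : VanishesAt (fun z => f z - inclOf D d) θ 1 := by
    have hf' := A.calderon.sub_mem hf (const_mem_calderon d.1)
    exact vanishesAt_one h0 h1 hf' (sub_eq_zero.2 hfd)
  obtain ⟨P, hP, Φ, hΦ1, -, b, hb, hb'⟩ := exists_calderon_family hD hM₀ hM hC hs0 hs1 hT hg h0 h1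
    hθ' d hf hv hε
  refine ⟨b, ⟨_, hb, ?_⟩, hb'⟩
  change Φ θ • T (θ / θ) (gaussAt θ θ ^ 2 • d + P θ) = T 1 d
  rw [hΦ1, gaussAt_self, simpleMaps_apply_self one_ne_zero hP, div_self hθc]
  simp

/-- Only T₁' d survives in the derivative at θ: Φ and the squared Gaussian are stationary there, and
P vanishes to second order. -/
theorem normLower_family_le (hD : Dense (D : Set A.Inter)) (hM₀ : 0 < M₀) (hM : 0 < M)
    (hC : 0 < C) (hs0 : 0 < s) (hs1 : s < 1) (hT : IsAnalyticFamily T)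
    (hg : HasGrowth T M₀ M₁ M C s) (h0 : 0 < θ) (h1 : θ < 1)
    (hθ' : θ * Real.log (max M₁ 1) ≤ 1) (d : D) :
    (ENNReal.ofReal θ)⁻¹ * B.normLower θ (deriv (fun ξ => T ξ d) 1) ≤
      ENNReal.ofReal (familyConst M₀ M C s) * A.normUpper θ (inclOf D d) := by
  have hθc : (θ : ℂ) ≠ 0 := by exact_mod_cast h0.ne'
  have hK := familyConst_pos (M₀ := M₀) (M := M) hC hs0 hs1
  rw [ENNReal.inv_mul_le_iff (by simpa using h0) ENNReal.ofReal_ne_top, ← mul_assoc,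
    ← ENNReal.ofReal_mul h0.le]
  refine ExtSeminorm.ofRel_le_mul (by positivity) fun g hgr ε hε => ?_
  obtain ⟨f, hf, hfd, hfd'⟩ := mem_boundaryRel_iff.1 hgr
  have hfd : f θ = inclOf D d := hfd
  have hfd' : HasDerivAt f 0 θ := hfd'
  have hv : VanishesAt (fun z => f z - inclOf D d) θ 2 := by
    have hf' := A.calderon.sub_mem hf (const_mem_calderon d.1)
    exact vanishesAt_two h0 h1 hf' (sub_eq_zero.2 hfd) (hfd'.sub_const (inclOf D d))
  obtain ⟨P, hP, Φ, hΦ1, hΦ', b, hb, hb'⟩ := exists_calderon_family hD hM₀ hM hC hs0 hs1 hT hg h0 h1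
    hθ' d hf hv hε
  -- The factor θ cancels the θ⁻¹ of the chain rule and at the same time supplies the weight on the
  -- right-hand side.
  refine ⟨(θ : ℂ) • b, ⟨_, B.calderon.smul_mem (θ : ℂ) hb, ?_⟩, ?_⟩
  · have hq : HasDerivAt (fun z => gaussAt θ z ^ 2) 0 θ := by
      have h2 : HasDerivAt (fun z : ℂ => (z - θ) ^ 2) 0 θ := by
        simpa using! ((hasDerivAt_id (θ : ℂ)).sub_const (θ : ℂ)).pow 2
      simpa [gaussAt] using! h2.cexp.pow 2
    have h3 := (hasDerivAt_family_comp_smul hT h0 d hq).add (hasDerivAt_family_comp hT h0 hP)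
    have h4 := (hΦ'.smul h3).const_smul (θ : ℂ)
    change HasDerivAt (fun z => (θ : ℂ) • (Φ z • T (z / θ) (gaussAt θ z ^ 2 • d + P z)))
      (deriv (fun ξ => T ξ d) 1) θ
    have e1 : (fun z => (θ : ℂ) • (Φ z • T (z / θ) (gaussAt θ z ^ 2 • d + P z))) =
        fun z => (θ : ℂ) • (Φ z • (T (z / θ) (gaussAt θ z ^ 2 • d) + T (z / θ) (P z))) := by
      funext z
      rw [map_add]
    rw [e1]
    convert! h4 using 1
    simp [hΦ1, gaussAt_self, smul_smul, hθc]
  · rw [norm_smul, Complex.norm_real, Real.norm_of_nonneg h0.le]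
    calc θ * ‖b‖ ≤ θ * (familyConst M₀ M C s * ‖g‖ + ε) := by gcongr
      _ ≤ _ := by nlinarith

/-! ### The limit θ → 0⁺ -/

/-- M₁ determines only how small θ must be, not the constants of the estimates, so the upper limits
do not see it. The maximum with 1 covers values of M₁ below 1, including negative ones. -/
theorem eventually_mul_log_le (M₁ : ℝ) :
    ∀ᶠ θ : ℝ in 𝓝[>] (0 : ℝ), 0 < θ ∧ θ < 1 ∧ θ * Real.log (max M₁ 1) ≤ 1 := by
  have h1 : Tendsto (fun θ : ℝ => θ * Real.log (max M₁ 1)) (𝓝[>] 0) (𝓝 (0 * _)) :=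
    (tendsto_id.mono_left nhdsWithin_le_nhds).mul_const _
  rw [zero_mul] at h1
  filter_upwards [self_mem_nhdsWithin, h1.eventually_le_const one_pos,
    nhdsWithin_le_nhds (eventually_lt_nhds one_pos)] with θ h2 h3 h4
  exact ⟨h2, h4, h3⟩

theorem ofRel_boundaryRel_const_le {P : Submodule ℂ ((ℂ → A.Sum) × A.Sum)} (x : A.Inter)
    (hP : ((fun _ => A.inclInter x, A.inclInter x) : (ℂ → A.Sum) × A.Sum) ∈ P) :
    ExtSeminorm.ofRel (A.boundaryRel P) (A.inclInter x) ≤ ‖x‖ₑ := by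
  refine (iInf₂_le (BoundedContinuousFunction.const ℝ x.1.1, BoundedContinuousFunction.const ℝ x.1.2)
    ⟨_, const_mem_calderon x, hP⟩).trans ?_
  rw [← ofReal_norm, ← ofReal_norm]
  refine ENNReal.ofReal_le_ofReal ?_
  exact max_le_max (BoundedContinuousFunction.norm_const_le _)
    (BoundedContinuousFunction.norm_const_le _)

theorem endpoint_inclOf_le (d : D) : A.endpoint (inclOf D d) ≤ ‖d.1‖ₑ := by
  refine limsup_le_of_le (by isBoundedDefault) (Eventually.of_forall fun θ => ?_)
  rw [one_mul]
  exact ofRel_boundaryRel_const_le d.1 rfl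

theorem endpoint_inclOf_lt_top (d : D) : A.endpoint (inclOf D d) < ∞ :=
  (endpoint_inclOf_le d).trans_lt enorm_lt_top

theorem endpointUpper_inclOf_lt_top (d : D) : A.endpointUpper (inclOf D d) < ∞ := by
  refine lt_of_le_of_lt ?_ (enorm_lt_top (x := d.1))
  refine limsup_le_of_le (by isBoundedDefault) (Eventually.of_forall fun θ => ?_)
  rw [one_mul]
  exact ofRel_boundaryRel_const_le d.1 ⟨rfl, hasDerivAt_const _ _⟩

theorem endpoint_family_le (hD : Dense (D : Set A.Inter)) (hM₀ : 0 < M₀) (hM : 0 < M)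
    (hC : 0 < C) (hs0 : 0 < s) (hs1 : s < 1) (hT : IsAnalyticFamily T)
    (hg : HasGrowth T M₀ M₁ M C s) (d : D) :
    B.endpoint (T 1 d) ≤ ENNReal.ofReal (familyConst M₀ M C s) * A.endpoint (inclOf D d) := by
  change limsup _ _ ≤ _ * limsup _ _
  rw [← ENNReal.limsup_const_mul_of_ne_top ENNReal.ofReal_ne_top]
  refine limsup_le_limsup ?_
  filter_upwards [eventually_mul_log_le M₁] with θ ⟨h0, h1, h2⟩
  rw [one_mul, one_mul]
  exact normTheta_family_le hD hM₀ hM hC hs0 hs1 hT hg h0 h1 h2 d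

theorem endpointLower_family_le (hD : Dense (D : Set A.Inter)) (hM₀ : 0 < M₀) (hM : 0 < M)
    (hC : 0 < C) (hs0 : 0 < s) (hs1 : s < 1) (hT : IsAnalyticFamily T)
    (hg : HasGrowth T M₀ M₁ M C s) (d : D) :
    B.endpointLower (deriv (fun ξ => T ξ d) 1) ≤
      ENNReal.ofReal (familyConst M₀ M C s) * A.endpointUpper (inclOf D d) := by
  change limsup _ _ ≤ _ * limsup _ _
  rw [← ENNReal.limsup_const_mul_of_ne_top ENNReal.ofReal_ne_top]
  refine limsup_le_limsup ?_
  filter_upwards [eventually_mul_log_le M₁] with θ ⟨h0, h1, h2⟩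
  rw [one_mul]
  exact normLower_family_le hD hM₀ hM hC hs0 hs1 hT hg h0 h1 h2 d

end

end CompatibleCouple

namespace CompatibleCouple

section

variable {A B : CompatibleCouple} {D : Submodule ℂ A.Inter} {T : ℂ → D →ₗ[ℂ] B.Sum}
  {M₀ M₁ M C s : ℝ}

theorem isBoundedExt_family (hD : Dense (D : Set A.Inter)) (hM₀ : 0 < M₀) (hM : 0 < M)
    (hC : 0 < C) (hs0 : 0 < s) (hs1 : s < 1) (hT : IsAnalyticFamily T)
    (hg : HasGrowth T M₀ M₁ M C s) :
    IsBoundedExt (A.endpoint.comap (inclOf D)) B.endpoint (fun d => T 1 d)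
      (familyConst M₀ M C s) := by
  refine ExtSeminorm.isBoundedExt_of_le (familyConst_pos hC hs0 hs1).le ?_ ?_ ?_ ?_
  · intro x y
    exact map_add (T 1) x y
  · intro c x
    exact map_smul (T 1) c x
  · intro d
    rw [ExtSeminorm.comap_apply]
    exact endpoint_inclOf_lt_top d
  · intro d
    rw [ExtSeminorm.comap_apply]
    exact endpoint_family_le hD hM₀ hM hC hs0 hs1 hT hg d

theorem isBoundedExt_deriv_family (hD : Dense (D : Set A.Inter)) (hM₀ : 0 < M₀) (hM : 0 < M)
    (hC : 0 < C) (hs0 : 0 < s) (hs1 : s < 1) (hT : IsAnalyticFamily T)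
    (hg : HasGrowth T M₀ M₁ M C s) :
    IsBoundedExt (A.endpointUpper.comap (inclOf D)) B.endpointLower
      (fun d => deriv (fun ξ => T ξ d) 1) (familyConst M₀ M C s) := by
  have hd : ∀ d : D, DifferentiableAt ℂ (fun ξ => T ξ d) 1 := fun d =>
    differentiableAt_family hT d (by simp)
  refine ExtSeminorm.isBoundedExt_of_le (familyConst_pos hC hs0 hs1).le ?_ ?_ ?_ ?_
  · intro x y
    have e : (fun ξ => T ξ (x + y)) = fun ξ => T ξ x + T ξ y := funext fun ξ => map_add (T ξ) x y
    rw [e]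
    exact deriv_fun_add (hd x) (hd y)
  · intro c x
    have e : (fun ξ => T ξ (c • x)) = fun ξ => c • T ξ x := funext fun ξ => map_smul (T ξ) c x
    rw [e]
    exact deriv_fun_const_smul c (hd x)
  · intro d
    rw [ExtSeminorm.comap_apply]
    exact endpointUpper_inclOf_lt_top d
  · intro d
    rw [ExtSeminorm.comap_apply]
    exact endpointLower_family_le hD hM₀ hM hC hs0 hs1 hT hg d

end

end CompatibleCouple

theorem IsBoundedExt.apply_le {E F : Type*} [AddCommGroup E] [Module ℂ E] [AddCommGroup F]
    [Module ℂ F] {p : ExtSeminorm E} {q : ExtSeminorm F} {L : E → F} {K : ℝ}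
    (h : IsBoundedExt p q L K) (x : E) : q (L x) ≤ ENNReal.ofReal K * p x := by
  obtain ⟨S, hS, hSL⟩ := h
  obtain ⟨hx, hLx, hSx⟩ := hSL x
  have hK : 0 ≤ K := (norm_nonneg S).trans hS
  have h1 := S.le_of_opNorm_le hS (p.point x hx : p.Compl)
  rw [hSx, UniformSpace.Completion.norm_coe, UniformSpace.Completion.norm_coe,
    ExtSeminorm.norm_point, ExtSeminorm.norm_point] at h1
  rw [← ENNReal.ofReal_toReal hLx.ne, ← ENNReal.ofReal_toReal hx.ne, ← ENNReal.ofReal_mul hK]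
  exact ENNReal.ofReal_le_ofReal h1

/-! ### Lower bounds for the endpoint norm -/

namespace CompatibleCouple

section

variable {A : CompatibleCouple} {θ : ℝ}

variable (A) in
/-- The inclusion of `A₀ + A₁` into the ambient space. -/
noncomputable def ambient : A.Sum →L[ℂ] A.V :=
  A.nullPairs.liftQL
    ((A.ι₀.comp (ContinuousLinearMap.fst ℂ A.X₀ A.X₁) +
      A.ι₁.comp (ContinuousLinearMap.snd ℂ A.X₀ A.X₁)).comp
        (WithLp.prodContinuousLinearEquiv 1 ℂ A.X₀ A.X₁).toContinuousLinearMap) fun _ hx => hx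

theorem ambient_incl₀ (x : A.X₀) : A.ambient (A.incl₀ x) = A.ι₀ x := by
  change A.ι₀ x + A.ι₁ 0 = _
  rw [map_zero, add_zero]

theorem ambient_incl₁ (x : A.X₁) : A.ambient (A.incl₁ x) = A.ι₁ x := by
  change A.ι₀ 0 + A.ι₁ x = _
  rw [map_zero, zero_add]

/-- The three lines theorem: exp(-cz) l(f(z)) is bounded by ‖g‖ on both edges. -/
theorem norm_le_mul_of_mem_calderon {f : ℂ → A.Sum} {g : (ℝ →ᵇ A.X₀) × (ℝ →ᵇ A.X₁)}
    (hf : (f, g) ∈ A.calderon) {l : StrongDual ℂ A.Sum} {c : ℝ}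
    (hl₀ : ∀ x, ‖l (A.incl₀ x)‖ ≤ ‖x‖) (hl₁ : ∀ x, ‖l (A.incl₁ x)‖ ≤ Real.exp c * ‖x‖)
    (h0 : 0 < θ) (h1 : θ < 1) : ‖l (f θ)‖ ≤ Real.exp (c * θ) * ‖g‖ := by
  obtain ⟨⟨hcont, hdiff, R, hR⟩, hf0, hf1⟩ := And.imp_left (fun h => h l) hf
  have hclos : closure (Complex.re ⁻¹' Ioo 0 1) = {z | 0 ≤ z.re ∧ z.re ≤ 1} := by
    rw [Complex.closure_preimage_re, closure_Ioo zero_ne_one]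
    rfl
  have hE : Differentiable ℂ fun z : ℂ => Complex.exp (-(c * z)) := by fun_prop
  have hnE : ∀ z : ℂ, ‖Complex.exp (-(c * z))‖ = Real.exp (-(c * z.re)) := fun z => by
    rw [Complex.norm_exp]
    simp
  have key : ‖Complex.exp (-(c * θ)) * l (f θ)‖ ≤ ‖g‖ := by
    refine PhragmenLindelof.vertical_strip (a := 0) (b := 1)
      (f := fun z => Complex.exp (-(c * z)) * l (f z)) ⟨hE.differentiableOn.mul hdiff, ?_⟩
      ⟨0, by simpa using Real.pi_pos, 0, ?_⟩ (fun z hz => ?_) (fun z hz => ?_)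
      (by simpa using h0.le) (by simpa using h1.le)
    · rw [hclos]
      exact hE.continuous.continuousOn.mul hcont
    · refine Asymptotics.IsBigO.of_bound (Real.exp |c| * R) ?_
      filter_upwards [mem_inf_of_right (mem_principal_self _)] with z hz
      have hz : 0 < z.re ∧ z.re < 1 := hz
      rw [norm_mul, hnE]
      simp only [zero_mul, Real.exp_zero, norm_one, mul_one]
      have e1 : -(c * z.re) ≤ |c| := by
        refine (neg_le_abs _).trans ?_
        rw [abs_mul, abs_of_pos hz.1]
        exact mul_le_of_le_one_right (abs_nonneg c) hz.2.le
      gcongr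
      exact hR z hz.1.le hz.2.le
    · have e : z = z.im * Complex.I := by
        apply Complex.ext <;> simp [hz]
      have e' : f z = A.incl₀ (g.1 z.im) := (congrArg f e).trans (hf0 z.im)
      rw [norm_mul, hnE, hz, mul_zero, neg_zero, Real.exp_zero, one_mul, e']
      exact (hl₀ _).trans ((g.1.norm_coe_le_norm _).trans (norm_fst_le g))
    · have e : z = 1 + z.im * Complex.I := by
        apply Complex.ext <;> simp [hz]
      have e' : f z = A.incl₁ (g.2 z.im) := (congrArg f e).trans (hf1 z.im)
      rw [norm_mul, hnE, hz, mul_one, e', Real.exp_neg, inv_mul_le_iff₀ (Real.exp_pos _)]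
      refine (hl₁ _).trans ?_
      gcongr
      exact (g.2.norm_coe_le_norm _).trans (norm_snd_le g)
  rw [norm_mul, hnE, Complex.ofReal_re, Real.exp_neg, inv_mul_le_iff₀ (Real.exp_pos _)] at key
  exact key

theorem enorm_le_mul_normTheta {l : StrongDual ℂ A.Sum} {c : ℝ}
    (hl₀ : ∀ x, ‖l (A.incl₀ x)‖ ≤ ‖x‖) (hl₁ : ∀ x, ‖l (A.incl₁ x)‖ ≤ Real.exp c * ‖x‖)
    (h0 : 0 < θ) (h1 : θ < 1) (a : A.Sum) :
    ‖l a‖ₑ ≤ ENNReal.ofReal (Real.exp (c * θ)) * A.normTheta θ a := by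
  change _ ≤ ENNReal.ofReal _ * ⨅ (g : _) (_ : (g, a) ∈ A.boundaryRel (A.valueAt θ)), ‖g‖ₑ
  have hK0 : ENNReal.ofReal (Real.exp (c * θ)) ≠ 0 := by simpa using Real.exp_pos _
  rw [ENNReal.mul_iInf_of_ne hK0 ENNReal.ofReal_ne_top]
  refine le_iInf fun g => ?_
  rw [ENNReal.mul_iInf_of_ne hK0 ENNReal.ofReal_ne_top]
  refine le_iInf fun hg => ?_
  obtain ⟨f, hf, hfa⟩ := mem_boundaryRel_iff.1 hg
  have hfa : f θ = a := hfa
  rw [← ofReal_norm, ← ofReal_norm, ← ENNReal.ofReal_mul (Real.exp_pos _).le, ← hfa]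
  exact ENNReal.ofReal_le_ofReal (norm_le_mul_of_mem_calderon hf hl₀ hl₁ h0 h1)

/-- The factor exp(cθ) from the three lines theorem tends to 1, so the size of l on A₁ becomes
irrelevant at the endpoint. -/
theorem enorm_le_endpoint {l : StrongDual ℂ A.Sum} {c : ℝ}
    (hl₀ : ∀ x, ‖l (A.incl₀ x)‖ ≤ ‖x‖) (hl₁ : ∀ x, ‖l (A.incl₁ x)‖ ≤ Real.exp c * ‖x‖)
    (a : A.Sum) : ‖l a‖ₑ ≤ A.endpoint a := by
  have h1 : Tendsto (fun θ : ℝ => ENNReal.ofReal (Real.exp (-(c * θ))) * ‖l a‖ₑ) (𝓝[>] 0)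
      (𝓝 (1 * ‖l a‖ₑ)) := by
    refine ENNReal.Tendsto.mul_const ?_ (Or.inr enorm_ne_top)
    have h2 : Continuous fun θ : ℝ => ENNReal.ofReal (Real.exp (-(c * θ))) :=
      ENNReal.continuous_ofReal.comp (by fun_prop)
    simpa using (h2.tendsto 0).mono_left nhdsWithin_le_nhds
  rw [one_mul] at h1
  rw [← h1.limsup_eq]
  change _ ≤ limsup _ _
  refine limsup_le_limsup ?_
  filter_upwards [eventually_mul_log_le 0] with θ ⟨h0, h1, _⟩
  rw [one_mul, Real.exp_neg, ENNReal.ofReal_inv_of_pos (Real.exp_pos _), mul_comm,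
    ← div_eq_mul_inv]
  refine ENNReal.div_le_of_le_mul' ?_
  exact enorm_le_mul_normTheta hl₀ hl₁ h0 h1 a

end

end CompatibleCouple

/-! ### The counterexample for exponent one: scalar functions -/

/-- The function `y ^ ξ ξ ^ (-ξ)` on the right half-plane. -/
noncomputable def gammaLike (y : ℝ) (ξ : ℂ) : ℂ :=
  Complex.exp (ξ * (Real.log y - Complex.log ξ))

theorem gammaLike_one {y : ℝ} (hy : 0 < y) : gammaLike y 1 = y := by
  rw [gammaLike, Complex.log_one, sub_zero, one_mul, ← Complex.ofReal_exp, Real.exp_log hy]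

theorem differentiableOn_gammaLike (y : ℝ) :
    DifferentiableOn ℂ (gammaLike y) {ξ | 0 < ξ.re} := by
  intro ξ hξ
  have h : DifferentiableAt ℂ Complex.log ξ := Complex.differentiableAt_log (Or.inl hξ)
  exact ((differentiableAt_id.mul (h.const_sub _)).cexp).differentiableWithinAt

/-- The argument of ξ is bounded, so only |ξ| log |ξ| → 0 matters. It gives continuity of
`gammaLike` at the corner ξ = 0, where the convention log 0 = 0 yields the right value. -/
theorem tendsto_mul_log_zero : Tendsto (fun ξ : ℂ => ξ * Complex.log ξ) (𝓝 0) (𝓝 0) := by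
  have h1 : Tendsto (fun ξ : ℂ => |‖ξ‖ * Real.log ‖ξ‖| + ‖ξ‖ * Real.pi) (𝓝 0) (𝓝 0) := by
    have : Continuous fun ξ : ℂ => |‖ξ‖ * Real.log ‖ξ‖| + ‖ξ‖ * Real.pi :=
      ((Real.continuous_mul_log.comp continuous_norm).abs).add (by fun_prop)
    simpa using this.tendsto 0
  refine squeeze_zero_norm (fun ξ => ?_) h1
  rw [norm_mul, abs_mul, abs_norm, ← mul_add]
  gcongr
  refine (Complex.norm_le_abs_re_add_abs_im _).trans ?_
  rw [Complex.log_re, Complex.log_im]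
  gcongr
  exact Complex.abs_arg_le_pi ξ

theorem continuousOn_gammaLike (y : ℝ) : ContinuousOn (gammaLike y) {ξ | 0 ≤ ξ.re} := by
  intro ξ hξ
  suffices h : ContinuousAt (fun ξ : ℂ => ξ * Complex.log ξ) ξ by
    have : ContinuousAt (fun ξ : ℂ => Complex.exp (ξ * Real.log y - ξ * Complex.log ξ)) ξ :=
      (ContinuousAt.sub (by fun_prop) h).cexp
    simp only [← mul_sub] at this
    exact this.continuousWithinAt
  rcases eq_or_ne ξ 0 with rfl | h0
  · simpa [ContinuousAt] using tendsto_mul_log_zero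
  · refine continuousAt_id.mul (continuousAt_clog ?_)
    rcases (show 0 ≤ ξ.re from hξ).lt_or_eq with h | h
    · exact Or.inl h
    · exact Or.inr fun hi => h0 (Complex.ext h.symm hi)

theorem norm_gammaLike (y : ℝ) (ξ : ℂ) :
    ‖gammaLike y ξ‖ =
      Real.exp (ξ.re * (Real.log y - Real.log ‖ξ‖) + ξ.im * Complex.arg ξ) := by
  rw [gammaLike, Complex.norm_exp]
  simp [Complex.mul_re, Complex.log_re, Complex.log_im]

theorem im_mul_arg_le {ξ : ℂ} (hξ : 0 ≤ ξ.re) : ξ.im * Complex.arg ξ ≤ Real.pi / 2 * |ξ.im| := by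
  refine (le_abs_self _).trans ?_
  rw [abs_mul, mul_comm]
  gcongr
  exact Complex.abs_arg_le_pi_div_two_iff.2 hξ

/-- On the imaginary axis y ^ ξ has modulus at most 1 and only the argument of ξ contributes, which
gives growth of order exactly one, uniformly in y. -/
theorem norm_gammaLike_mul_I_le (y t : ℝ) :
    ‖gammaLike y (t * Complex.I)‖ ≤ Real.exp (Real.pi / 2 * |t|) := by
  rw [norm_gammaLike]
  refine Real.exp_le_exp.2 ?_
  have h := im_mul_arg_le (ξ := t * Complex.I) (by simp)
  simpa using h

/-- The real part of the exponent is at most α log(y / α) + π |t| / 2, and α log(y / α) ≤ y for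
every α > 0, so the bound is uniform in α. -/
theorem norm_gammaLike_le {y α : ℝ} (hy : 0 < y) (hα : 0 < α) (t : ℝ) :
    ‖gammaLike y (α + t * Complex.I)‖ ≤ Real.exp y * Real.exp (Real.pi / 2 * |t|) := by
  rw [norm_gammaLike, ← Real.exp_add]
  refine Real.exp_le_exp.2 ?_
  have h := im_mul_arg_le (ξ := α + t * Complex.I) (by simpa using hα.le)
  have h2 : α ≤ ‖(α + t * Complex.I : ℂ)‖ := by
    simpa using Complex.re_le_norm (α + t * Complex.I)
  have h3 := Real.log_le_log hα h2
  have h4 : Real.log (y / α) ≤ y / α := Real.log_le_self (by positivity)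
  rw [Real.log_div hy.ne' hα.ne', le_div_iff₀ hα] at h4
  simp only [Complex.add_re, Complex.ofReal_re, Complex.re_ofReal_mul, Complex.I_re, mul_zero,
    add_zero, Complex.add_im, Complex.ofReal_im, Complex.im_ofReal_mul, Complex.I_im, mul_one,
    zero_add] at h ⊢
  nlinarith

/-! ### The counterexample for exponent one: diagonal operators on ℓ¹ -/

/-- The finite sum of the `c n * g n` times the unit vectors of `ℓ¹`. -/
noncomputable def finiteSum (g : ℕ → ℂ) : (ℕ →₀ ℂ) →ₗ[ℂ] lp (fun _ : ℕ => ℂ) 1 :=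
  Finsupp.linearCombination ℂ fun n => g n • lp.single 1 n (1 : ℂ)

theorem finiteSum_eq (g : ℕ → ℂ) (c : ℕ →₀ ℂ) :
    finiteSum g c = ∑ n ∈ c.support, (c n * g n) • lp.single 1 n (1 : ℂ) := by
  rw [finiteSum, Finsupp.linearCombination_apply, Finsupp.sum]
  simp only [smul_smul]

theorem finiteSum_eq_sum_single (g : ℕ → ℂ) (c : ℕ →₀ ℂ) :
    finiteSum g c = ∑ n ∈ c.support, lp.single (E := fun _ : ℕ => ℂ) 1 n (c n * g n) := by
  rw [finiteSum_eq]
  refine Finset.sum_congr rfl fun n _ => ?_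
  rw [← lp.single_smul, smul_eq_mul, mul_one]

theorem finiteSum_apply (g : ℕ → ℂ) (c : ℕ →₀ ℂ) (m : ℕ) : finiteSum g c m = c m * g m := by
  rw [finiteSum_eq_sum_single, lp.coeFn_sum, Finset.sum_apply]
  simp only [lp.coeFn_single, Finset.sum_pi_single, Finsupp.mem_support_iff]
  split_ifs with h
  · rfl
  · rw [not_not.1 h, zero_mul]

theorem norm_finiteSum (g : ℕ → ℂ) (c : ℕ →₀ ℂ) :
    ‖finiteSum g c‖ = ∑ n ∈ c.support, ‖c n‖ * ‖g n‖ := by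
  have h := lp.norm_sum_single (E := fun _ : ℕ => ℂ) (p := 1) (by simp) (fun n => c n * g n)
    c.support
  rw [finiteSum_eq_sum_single]
  simpa using h

theorem norm_finiteSum_le {g : ℕ → ℂ} {R : ℝ} (hg : ∀ n, ‖g n‖ ≤ R) (c : ℕ →₀ ℂ) :
    ‖finiteSum g c‖ ≤ R * ‖finiteSum 1 c‖ := by
  rw [norm_finiteSum, norm_finiteSum, Finset.mul_sum]
  refine Finset.sum_le_sum fun n _ => ?_
  rw [Pi.one_apply, norm_one, mul_one, mul_comm]
  gcongr
  exact hg n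

theorem continuous_finiteSum {g : ℝ → ℕ → ℂ} (hg : ∀ n, Continuous fun t => g t n) (c : ℕ →₀ ℂ) :
    Continuous fun t => finiteSum (g t) c := by
  simp only [finiteSum_eq]
  exact continuous_finsetSum _ fun n _ => (continuous_const.mul (hg n)).smul continuous_const

theorem finiteSum_single (g : ℕ → ℂ) (n : ℕ) (a : ℂ) :
    finiteSum g (Finsupp.single n a) = lp.single 1 n (a * g n) := by
  ext m
  rw [finiteSum_apply, lp.single_apply, Finsupp.single_apply]
  rcases eq_or_ne n m with rfl | h
  · simp
  · simp [h, h.symm]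

theorem finiteSum_injective : Function.Injective (finiteSum 1) := by
  intro c c' h
  ext n
  have := congrArg (fun x : lp (fun _ : ℕ => ℂ) 1 => x n) h
  simpa [finiteSum_apply] using this

theorem denseRange_finiteSum : DenseRange (finiteSum 1) := by
  intro x
  have h := lp.hasSum_single (E := fun _ : ℕ => ℂ) ENNReal.one_ne_top x
  refine mem_closure_of_tendsto h (Eventually.of_forall fun s => ?_)
  refine ⟨∑ n ∈ s, Finsupp.single n (x n), ?_⟩
  rw [map_sum]
  refine Finset.sum_congr rfl fun n _ => ?_
  rw [finiteSum_single, Pi.one_apply, mul_one]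

namespace CompatibleCouple

/-- The couple `(ℓ¹, ℓ¹(w))` of a space of summable sequences and a weighted one; the latter is
represented as the space of the summable sequences with the inclusion `x ↦ w x`. -/
noncomputable def weighted (w : ℕ → ℂ) (hw : ∀ n, w n ≠ 0) : CompatibleCouple.{0, 0, 0} where
  X₀ := lp (fun _ : ℕ => ℂ) 1
  X₁ := lp (fun _ : ℕ => ℂ) 1
  V := ℕ → ℂ
  ι₀ := ContinuousLinearMap.pi fun n => lp.evalCLM ℂ (fun _ : ℕ => ℂ) 1 n
  ι₁ := ContinuousLinearMap.pi fun n => w n • lp.evalCLM ℂ (fun _ : ℕ => ℂ) 1 n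
  inj₀ _ _ h := lp.ext (funext fun n => congrFun h n)
  inj₁ _ _ h := lp.ext (funext fun n => mul_left_cancel₀ (hw n) (congrFun h n))

section

variable {w : ℕ → ℂ} {hw : ∀ n, w n ≠ 0}

variable (w hw) in
/-- The `n`-th coordinate, as a functional on `A₀ + A₁`. -/
noncomputable def coordDual (n : ℕ) : StrongDual ℂ (weighted w hw).Sum :=
  (ContinuousLinearMap.proj (R := ℂ) (φ := fun _ : ℕ => ℂ) n).comp (weighted w hw).ambient

theorem coordDual_incl₀ (n : ℕ) (x : lp (fun _ : ℕ => ℂ) 1) :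
    coordDual w hw n ((weighted w hw).incl₀ x) = x n :=
  congrFun (ambient_incl₀ (A := weighted w hw) x) n

theorem coordDual_incl₁ (n : ℕ) (x : lp (fun _ : ℕ => ℂ) 1) :
    coordDual w hw n ((weighted w hw).incl₁ x) = w n * x n :=
  congrFun (ambient_incl₁ (A := weighted w hw) x) n

theorem enorm_le_endpoint_weighted {n : ℕ} {c : ℝ} (hc : ‖w n‖ ≤ Real.exp c)
    (x : lp (fun _ : ℕ => ℂ) 1) :
    ‖x n‖ₑ ≤ (weighted w hw).endpoint ((weighted w hw).incl₀ x) := by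
  rw [← coordDual_incl₀ (w := w) (hw := hw) n x]
  refine enorm_le_endpoint (c := c) (fun y => ?_) (fun y => ?_) _
  · exact (congrArg norm (coordDual_incl₀ n y)).le.trans (lp.norm_apply_le_norm one_ne_zero y n)
  · refine (congrArg norm (coordDual_incl₁ n y)).le.trans ?_
    rw [norm_mul]
    exact mul_le_mul hc (lp.norm_apply_le_norm one_ne_zero y n) (norm_nonneg _)
      (Real.exp_pos c).le

/-- Vectors of the second space are stored divided by the weight, so a large w makes its norm small;
this is what absorbs large diagonal entries. -/
theorem incl₀_finiteSum_eq (g : ℕ → ℂ) (c : ℕ →₀ ℂ) :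
    (weighted w hw).incl₀ (finiteSum g c) =
      (weighted w hw).incl₁ (finiteSum (fun n => (w n)⁻¹ * g n) c) := by
  refine (incl₀_eq_incl₁_iff _).2 (funext fun n => ?_)
  change finiteSum g c n = w n * finiteSum _ c n
  rw [finiteSum_apply, finiteSum_apply]
  field_simp [hw n]

theorem dual_incl₀_finiteSum (l : StrongDual ℂ (weighted w hw).Sum) (g : ℕ → ℂ) (c : ℕ →₀ ℂ) :
    l ((weighted w hw).incl₀ (finiteSum g c)) =
      ∑ n ∈ c.support, c n * g n * l ((weighted w hw).incl₀ (lp.single 1 n (1 : ℂ))) := by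
  rw [finiteSum_eq]
  have h := map_sum ((l : (weighted w hw).Sum →ₗ[ℂ] ℂ) ∘ₗ (weighted w hw).incl₀)
    (fun n => (c n * g n) • (lp.single 1 n (1 : ℂ) : lp (fun _ : ℕ => ℂ) 1)) c.support
  refine h.trans (Finset.sum_congr rfl fun n _ => ?_)
  exact map_smul ((l : (weighted w hw).Sum →ₗ[ℂ] ℂ) ∘ₗ (weighted w hw).incl₀) (c n * g n) _

end

/-- The finitely supported sequences, in the couple `(ℓ¹, ℓ¹)`. -/
noncomputable def finiteInter : (ℕ →₀ ℂ) →ₗ[ℂ] (weighted 1 fun _ => one_ne_zero).Inter :=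
  ((finiteSum 1).prod (finiteSum 1)).codRestrict _ fun _ => funext fun _ => (one_mul _).symm

theorem finiteInter_injective : Function.Injective finiteInter := fun _ _ h =>
  finiteSum_injective (congrArg (fun x => x.1.1) h)

theorem dense_range_finiteInter :
    Dense (LinearMap.range finiteInter : Set (weighted 1 fun _ => one_ne_zero).Inter) := by
  intro x
  rw [Metric.mem_closure_iff]
  intro ε hε
  obtain ⟨y, ⟨c, rfl⟩, hy⟩ := Metric.mem_closure_iff.1 (denseRange_finiteSum x.1.1) ε hε
  refine ⟨finiteInter c, ⟨c, rfl⟩, ?_⟩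
  -- With weight 1 the two components of a vector of the intersection coincide, so density in ℓ¹ is
  -- enough.
  have hx : x.1.2 = x.1.1 := lp.ext (funext fun n => ((one_mul _).symm.trans (congrFun x.2 n).symm))
  refine max_lt hy ?_
  change dist x.1.2 (finiteSum 1 c) < ε
  rw [hx]
  exact hy

/-- The weight of the second space in the counterexample for the exponent `1`. -/
noncomputable def expWeight (n : ℕ) : ℂ := Real.exp (n + 1)

theorem expWeight_ne_zero (n : ℕ) : expWeight n ≠ 0 := by
  simp [expWeight]

theorem norm_expWeight (n : ℕ) : ‖expWeight n‖ = Real.exp (n + 1) := by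
  rw [expWeight, Complex.norm_real, Real.norm_of_nonneg (Real.exp_pos _).le]

/-- The diagonal operators with the entries `(n + 1) ^ ξ ξ ^ (-ξ)`. -/
noncomputable def gammaFamily (ξ : ℂ) :
    LinearMap.range finiteInter →ₗ[ℂ] (weighted expWeight expWeight_ne_zero).Sum :=
  (weighted expWeight expWeight_ne_zero).incl₀ ∘ₗ finiteSum (fun n => gammaLike (n + 1) ξ) ∘ₗ
    (LinearEquiv.ofInjective finiteInter finiteInter_injective).symm.toLinearMap

theorem gammaFamily_apply (ξ : ℂ) (c : ℕ →₀ ℂ) :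
    gammaFamily ξ ⟨finiteInter c, c, rfl⟩ =
      (weighted expWeight expWeight_ne_zero).incl₀
        (finiteSum (fun n => gammaLike (n + 1) ξ) c) := by
  have h : (LinearEquiv.ofInjective finiteInter finiteInter_injective).symm
      ⟨finiteInter c, c, rfl⟩ = c :=
    (LinearEquiv.ofInjective finiteInter finiteInter_injective).symm_apply_apply c
  change (weighted expWeight expWeight_ne_zero).incl₀ (finiteSum _
    ((LinearEquiv.ofInjective finiteInter finiteInter_injective).symm ⟨finiteInter c, c, rfl⟩)) = _
  rw [h]

theorem isAnalyticFamily_gammaFamily : IsAnalyticFamily gammaFamily where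
  continuousOn := by
    rintro ⟨_, c, rfl⟩ l
    simp only [gammaFamily_apply, dual_incl₀_finiteSum]
    exact continuousOn_finsetSum _ fun n _ =>
      (continuousOn_const.mul (continuousOn_gammaLike _)).mul continuousOn_const
  differentiableOn := by
    rintro ⟨_, c, rfl⟩ l
    simp only [gammaFamily_apply, dual_incl₀_finiteSum]
    exact DifferentiableOn.fun_sum fun n _ =>
      ((differentiableOn_gammaLike _).const_mul _).mul_const _
  continuous₀ := by
    rintro ⟨_, c, rfl⟩
    refine ⟨fun t => finiteSum (fun n => gammaLike (n + 1) (t * Complex.I)) c,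
      continuous_finiteSum (fun n => ?_) c, fun t => gammaFamily_apply _ c⟩
    exact (continuousOn_gammaLike _).comp_continuous (by fun_prop) (by simp)
  continuous₁ := by
    rintro ⟨_, c, rfl⟩ α hα
    refine ⟨fun t => finiteSum
      (fun n => (expWeight n)⁻¹ * gammaLike (n + 1) (α + t * Complex.I)) c,
      continuous_finiteSum (fun n => ?_) c,
      fun t => (gammaFamily_apply _ c).trans (incl₀_finiteSum_eq _ c)⟩
    exact continuous_const.mul
      ((continuousOn_gammaLike _).comp_continuous (by fun_prop) (by simpa using hα.le))

/-- The weight exp(n + 1) cancels the constant exp(y) of the half-plane bound at y = n + 1. Hence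
all constants are 1 except C = π / 2. -/
theorem hasGrowth_gammaFamily : HasGrowth gammaFamily 1 1 1 (Real.pi / 2) 1 where
  bound₀ := by
    rintro t ⟨_, c, rfl⟩
    refine ⟨_, gammaFamily_apply _ c, ?_⟩
    rw [one_mul, Real.rpow_one]
    exact norm_finiteSum_le (fun n => norm_gammaLike_mul_I_le _ t) c
  bound₁ := by
    rintro t α hα ⟨_, c, rfl⟩
    refine ⟨_, (gammaFamily_apply _ c).trans (incl₀_finiteSum_eq _ c), ?_⟩
    rw [Real.one_rpow, one_mul, one_mul, Real.rpow_one]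
    refine norm_finiteSum_le (fun n => ?_) c
    rw [norm_mul, norm_inv, norm_expWeight, inv_mul_le_iff₀ (Real.exp_pos _)]
    exact norm_gammaLike_le (by positivity) hα t

theorem not_isBoundedExt_gammaFamily (K : ℝ) :
    ¬ IsBoundedExt ((weighted 1 fun _ => one_ne_zero).endpoint.comap
        (inclOf (LinearMap.range finiteInter)))
      (weighted expWeight expWeight_ne_zero).endpoint (fun d => gammaFamily 1 d) K := by
  intro h
  -- The n-th unit vector has endpoint norm at most 1, while its image under T₁ has n-th coordinate
  -- n + 1 > K.
  obtain ⟨n, hn⟩ := exists_nat_gt K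
  let d : LinearMap.range finiteInter := ⟨finiteInter (Finsupp.single n 1), _, rfl⟩
  have hd : ‖d.1‖ₑ = 1 := by
    have h1 : ‖finiteSum 1 (Finsupp.single n 1)‖ = 1 := by
      rw [finiteSum_single, lp.norm_single one_pos]
      simp
    have h2 : ‖d.1‖ = 1 := (max_self _).trans h1
    rw [← ofReal_norm, h2, ENNReal.ofReal_one]
  have h1 := h.apply_le d
  rw [ExtSeminorm.comap_apply] at h1
  have h2 := h1.trans (mul_le_mul_right ((endpoint_inclOf_le d).trans hd.le) _)
  have h3 := enorm_le_endpoint_weighted (w := expWeight) (hw := expWeight_ne_zero)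
    (norm_expWeight n).le (finiteSum (fun n => gammaLike (n + 1) 1) (Finsupp.single n 1))
  rw [← gammaFamily_apply] at h3
  have h4 := h3.trans h2
  rw [finiteSum_apply, Finsupp.single_eq_same, one_mul, gammaLike_one (by positivity), mul_one,
    ← ofReal_norm, Complex.norm_real, Real.norm_of_nonneg (by positivity),
    ENNReal.ofReal_le_ofReal_iff'] at h4
  rcases h4 with h4 | h4
  · linarith
  · have : (0 : ℝ) ≤ n := n.cast_nonneg
    linarith

end CompatibleCouple

theorem mainTheorem1 :
    (∀ M₀ M C s : ℝ, 0 < M₀ → 0 < M → 0 < C → 0 < s → s < 1 →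
      ∃ K K' : ℝ, ∀ (A B : CompatibleCouple) (D : Submodule ℂ A.Inter),
        Dense (D : Set A.Inter) →
        ∀ (T : ℂ → D →ₗ[ℂ] B.Sum) (M₁ : ℝ),
          IsAnalyticFamily T → HasGrowth T M₀ M₁ M C s →
          IsBoundedExt (A.endpoint.comap (inclOf D)) B.endpoint (fun d => T 1 d) K ∧
          (∀ d : D, DifferentiableAt ℂ (fun ξ => T ξ d) 1) ∧
          IsBoundedExt (A.endpointUpper.comap (inclOf D)) B.endpointLower
            (fun d => deriv (fun ξ => T ξ d) 1) K') ∧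
    (∃ (A B : CompatibleCouple.{0, 0, 0}) (D : Submodule ℂ A.Inter)
        (T : ℂ → D →ₗ[ℂ] B.Sum) (M₀ M₁ M C : ℝ),
      Dense (D : Set A.Inter) ∧ 0 < M₀ ∧ 0 < M ∧ 0 < C ∧
        IsAnalyticFamily T ∧ HasGrowth T M₀ M₁ M C 1 ∧
        ¬ ∃ K : ℝ, IsBoundedExt (A.endpoint.comap (inclOf D)) B.endpoint (fun d => T 1 d) K) := by
  refine ⟨fun M₀ M C s hM₀ hM hC hs0 hs1 =>
    ⟨familyConst M₀ M C s, familyConst M₀ M C s, fun A B D hD T M₁ hT hg => ?_⟩, ?_⟩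
  · exact ⟨CompatibleCouple.isBoundedExt_family hD hM₀ hM hC hs0 hs1 hT hg,
      fun d => CompatibleCouple.differentiableAt_family hT d (by simp),
      CompatibleCouple.isBoundedExt_deriv_family hD hM₀ hM hC hs0 hs1 hT hg⟩
  · exact ⟨_, _, _, CompatibleCouple.gammaFamily, 1, 1, 1, Real.pi / 2,
      CompatibleCouple.dense_range_finiteInter, one_pos, one_pos, by positivity,
      CompatibleCouple.isAnalyticFamily_gammaFamily, CompatibleCouple.hasGrowth_gammaFamily,
      fun ⟨K, hK⟩ => CompatibleCouple.not_isBoundedExt_gammaFamily K hK⟩
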